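/- Let $\Lambda=\Lambda_0\oplus\Lambda_1$ be a finite-dimensional real unital associative $\mathbb{Z}/2$-graded algebra that is supercommutative, i.e. $ab=(-1)^{\sigma(a)\sigma(b)}ba$ for homogeneous $a,b$ of parities $\sigma(a),\sigma(b)$. Assume: $(A_0)$ $(e_0=1,e_1,\dots,e_p)$ is a basis of $\Lambda_0$ with $\sum_{k=0}^p e_k^2=0$; $(A_1)$ $(\varepsilon_1,\dots,\varepsilon_q)$ is a basis of $\Lambda_1$, and there are integers $1=s_1<s_2<\dots<s_{r+1}=q+1$ and elements $a_1,\dots,a_q\in\Lambda_0$ such that for every $k=1,\dots,r$: $\varepsilon_j=a_j\varepsilon_{s_k}$ for $s_k\le j<s_{k+1}$, $a_{s_k}=1$, and $\sum_{j=s_k}^{s_{k+1}-1}a_j^2=0$. Write points of $\Lambda_0^n\times\Lambda_1^m$ as $(y_1,\dots,y_n,\theta_1,\dots,\theta_m)$ with $y_i=\sum_{j=0}^p y_i^je_j$ and $\theta_l=\sum_{t=1}^q\theta_l^t\varepsilon_t$. A function $f:D\to\Lambda$ on an open set $D\subset\Lambda_0^n\times\Lambda_1^m$ is called qS-differentiable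 on $D$ if it is (real) Fréchet-differentiable at every point of $D$ and $d''f=0$ on $D$, where $$d''f=\sum_{i=1}^n\sum_{j=1}^p\Big(\frac{\partial f}{\partial y_i^j}-e_j\frac{\partial f}{\partial y_i^0}\Big)dy_i^j+\sum_{l=1}^m\sum_{k=1}^r\sum_{t=s_k+1}^{s_{k+1}-1}\Big(\frac{\partial f}{\partial\theta_l^t}-a_t\frac{\partial f}{\partial\theta_l^{s_k}}\Big)d\theta_l^t .$$ Let $n+m\ge 2$, and if $\Lambda_1=0$ let $n\ge2$. Let $\Omega$ be a bounded domain (non-empty connected open set) of $\Lambda_0^n\times\Lambda_1^m$ whose boundary $\partial\Omega$ is connected, let $V$ be an open neighbourhood of $\partial\Omega$, and let $f:V\to\Lambda$ be qS-differentiable on $V$. Then $f$ extends to a qS-differentiable function on $\Omega$: if $V_0$ denotes the connected component of $V$ containing $\partial\Omega$, there is a qS-differentiable function $F:\Omega\cup V_0\to\Lambda$ with $F=f$ on $V_0$. -/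

import Mathlib

namespace SuperAnalysis

/-- Supercommutativity of a `ℤ/2`-graded algebra: `ab = (-1)^{σ(a)σ(b)} ba` for homogeneous
`a`, `b`. -/
def IsSupercommutative {Λ : Type*} [Ring Λ] [Algebra ℝ Λ] (𝒜 : ZMod 2 → Submodule ℝ Λ) : Prop :=
  ∀ (i j : ZMod 2) (a b : Λ), a ∈ 𝒜 i → b ∈ 𝒜 j → a * b = (-1) ^ (i.val * j.val) * (b * a)

/-- The superspace `Λ₀ⁿ × Λ₁ᵐ`. -/
abbrev Superspace {Λ : Type*} [Ring Λ] [Algebra ℝ Λ] (𝒜 : ZMod 2 → Submodule ℝ Λ) (n m : ℕ) :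
    Type _ :=
  (Fin n → 𝒜 0) × (Fin m → 𝒜 1)

/-- A sequence `s₀ = 0 < s₁ < ⋯ < s_r = q`, cutting the index set `{0, …, q - 1}` into the `r`
nonempty consecutive blocks `{s_k, …, s_{k+1} - 1}`. Indices are shifted by one with respect to
the usual numbering `1 = s₁ < ⋯ < s_{r+1} = q + 1`. -/
structure BlockSeq (q r : ℕ) where
  s : Fin (r + 1) → ℕ
  strictMono : StrictMono s
  s_zero : s 0 = 0
  s_last : s (Fin.last r) = q

/-- The first index `s_k` of the `k`-th block. -/
def BlockSeq.lead {q r : ℕ} (S : BlockSeq q r) (k : Fin r) : Fin q :=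
  ⟨S.s k.castSucc, lt_of_lt_of_eq (S.strictMono (Fin.castSucc_lt_last k)) S.s_last⟩

/-- The `k`-th block of indices `s_k ≤ j < s_{k+1}`. -/
def BlockSeq.block {q r : ℕ} (S : BlockSeq q r) (k : Fin r) : Finset (Fin q) :=
  Finset.univ.filter fun j => S.s k.castSucc ≤ (j : ℕ) ∧ (j : ℕ) < S.s k.succ

section

variable {Λ : Type*} [NormedRing Λ] [NormedAlgebra ℝ Λ] (𝒜 : ZMod 2 → Submodule ℝ Λ)

/-- Condition `(A₀)` for the basis `(e₀, …, e_p)` of `Λ₀`: `e₀ = 1` and `∑ e_k² = 0`. -/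
def ConditionA0 {p : ℕ} (e : Module.Basis (Fin (p + 1)) ℝ (𝒜 0)) : Prop :=
  (e 0 : Λ) = 1 ∧ ∑ k, (e k : Λ) ^ 2 = 0

/-- Condition `(A₁)` for the basis `ε` of `Λ₁`, the blocks `S` and the even elements `a_j`:
on each block `ε_j = a_j ε_{s_k}`, `a_{s_k} = 1` and `∑ a_j² = 0`. -/
def ConditionA1 {q r : ℕ} (ε : Module.Basis (Fin q) ℝ (𝒜 1)) (S : BlockSeq q r)
    (a : Fin q → 𝒜 0) : Prop :=
  ∀ k : Fin r,
    (∀ j ∈ S.block k, (ε j : Λ) = (a j : Λ) * (ε (S.lead k) : Λ)) ∧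
    (a (S.lead k) : Λ) = 1 ∧
    ∑ j ∈ S.block k, (a j : Λ) ^ 2 = 0

variable {𝒜} {n m : ℕ}

/-- The real coordinate `x = (y, θ) ↦ y_i^j`, which is also the constant `1`-form `dy_i^j`. -/
noncomputable def dy {p : ℕ} (e : Module.Basis (Fin (p + 1)) ℝ (𝒜 0)) (i : Fin n)
    (j : Fin (p + 1)) : Superspace 𝒜 n m →ₗ[ℝ] ℝ :=
  e.coord j ∘ₗ LinearMap.proj i ∘ₗ LinearMap.fst ℝ (Fin n → 𝒜 0) (Fin m → 𝒜 1)

/-- The real coordinate `x = (y, θ) ↦ θ_l^t`, which is also the constant `1`-form `dθ_l^t`. -/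
noncomputable def dθ {q : ℕ} (ε : Module.Basis (Fin q) ℝ (𝒜 1)) (l : Fin m)
    (t : Fin q) : Superspace 𝒜 n m →ₗ[ℝ] ℝ :=
  ε.coord t ∘ₗ LinearMap.proj l ∘ₗ LinearMap.snd ℝ (Fin n → 𝒜 0) (Fin m → 𝒜 1)

/-- The real partial derivative `∂f/∂y_i^j`. -/
noncomputable def partialY {p : ℕ} (e : Module.Basis (Fin (p + 1)) ℝ (𝒜 0))
    (f : Superspace 𝒜 n m → Λ) (x : Superspace 𝒜 n m) (i : Fin n) (j : Fin (p + 1)) : Λ :=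
  fderiv ℝ f x (Pi.single i (e j), 0)

/-- The real partial derivative `∂f/∂θ_l^t`. -/
noncomputable def partialθ {q : ℕ} (ε : Module.Basis (Fin q) ℝ (𝒜 1))
    (f : Superspace 𝒜 n m → Λ) (x : Superspace 𝒜 n m) (l : Fin m) (t : Fin q) : Λ :=
  fderiv ℝ f x (0, Pi.single l (ε t))

/-- The Cauchy–Riemann operator on functions: the `Λ`-valued `1`-form
`d''f = ∑_i ∑_{j ≥ 1} dy_i^j (∂f/∂y_i^j - e_j ∂f/∂y_i^0)
  + ∑_l ∑_k ∑_{s_k < t < s_{k+1}} dθ_l^t (∂f/∂θ_l^t - a_t ∂f/∂θ_l^{s_k})`. -/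
noncomputable def cauchyRiemann {p q r : ℕ} (e : Module.Basis (Fin (p + 1)) ℝ (𝒜 0))
    (ε : Module.Basis (Fin q) ℝ (𝒜 1)) (S : BlockSeq q r) (a : Fin q → 𝒜 0)
    (f : Superspace 𝒜 n m → Λ) (x : Superspace 𝒜 n m) : Superspace 𝒜 n m →ₗ[ℝ] Λ :=
  (∑ i : Fin n, ∑ j : Fin p,
    (dy e i j.succ).smulRight
      (partialY e f x i j.succ - (e j.succ : Λ) * partialY e f x i 0)) +
  ∑ l : Fin m, ∑ k : Fin r, ∑ t ∈ (S.block k).erase (S.lead k),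
    (dθ ε l t).smulRight
      (partialθ ε f x l t - (a t : Λ) * partialθ ε f x l (S.lead k))

/-- `f` is quasi-superdifferentiable (qS-differentiable) on the open set `D`: it is
Fréchet-differentiable at every point of `D` and `d''f = 0` on `D`. -/
def QSDifferentiableOn {p q r : ℕ} (e : Module.Basis (Fin (p + 1)) ℝ (𝒜 0))
    (ε : Module.Basis (Fin q) ℝ (𝒜 1)) (S : BlockSeq q r) (a : Fin q → 𝒜 0)
    (f : Superspace 𝒜 n m → Λ) (D : Set (Superspace 𝒜 n m)) : Prop :=
  ∀ x ∈ D, DifferentiableAt ℝ f x ∧ cauchyRiemann e ε S a f x = 0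

end

end SuperAnalysis

/-!
The conjugate operator of the system `∂_t f = A_t ∂_{ℓ(t)} f` is `∑_t (∂_t + A_t ∂_{ℓ(t)})`: its
composition with `d''` is the real Laplacian, because the coefficients satisfy `∑ A_t² = 0` over
every block. Applied to the Newtonian potential it gives a Cauchy–Pompeiu formula, hence solutions
are real analytic.

The extension follows Ehrenpreis. For a cutoff `χ` equal to `1` on the part of `Ω` outside `V`, the
commutator `[d'', χ] f` is a compactly supported closed form, and the potential in the variables of
one single block solves `d''u = [d'', χ] f`. A linear form `l` which is constant along this block
attains its maximum over the closure of `Ω` at a boundary point only. Near such a point `l` avoids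
`l (supp χ)`, so both `χ` and `u` vanish there and `(1 - χ) f + u` coincides with `f`, hence on all
of `V` by the identity theorem.
-/

namespace SuperAnalysis

open MeasureTheory Filter Topology Set Bornology Metric
open scoped ContDiff Manifold

theorem integral_divergence_eq_zero {W : Type*} [NormedAddCommGroup W] [NormedSpace ℝ W] {n : ℕ}
    (X : Fin (n + 1) → (Fin (n + 1) → ℝ) → W) (hd : ∀ i, Differentiable ℝ (X i))
    (hc : ∀ i, HasCompactSupport (X i))
    (hi : Integrable fun x => ∑ i, fderiv ℝ (X i) x (Pi.single i 1)) :
    ∫ x, ∑ i, fderiv ℝ (X i) x (Pi.single i 1) = 0 := by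
  obtain ⟨R, hR0, hR⟩ : ∃ R : ℝ, 0 < R ∧ ⋃ i, tsupport (X i) ⊆ Metric.ball 0 R :=
    (isCompact_iUnion fun i => hc i).isBounded.subset_ball_lt 0 0
  have hzero : ∀ i x, R ≤ ‖x‖ → x ∉ tsupport (X i) := fun i x hx hmem =>
    hx.not_gt (mem_ball_zero_iff.1 (hR (mem_iUnion_of_mem i hmem)))
  have hface : ∀ (i : Fin (n + 1)) (c : ℝ), |c| = R → ∀ x : Fin n → ℝ,
      X i (i.insertNth c x) = 0 := fun i c hcR x => by
    refine image_eq_zero_of_notMem_tsupport (hzero i _ ?_)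
    simpa [hcR] using norm_le_pi_norm (i.insertNth c x : Fin (n + 1) → ℝ) i
  have hbox := integral_divergence_of_hasFDerivAt_off_countable' (fun _ => -R) (fun _ => R)
    (fun _ => by linarith) X (fun i x => fderiv ℝ (X i) x) ∅ countable_empty
    (fun i => (hd i).continuous.continuousOn) (fun x _ i => (hd i x).hasFDerivAt) hi.integrableOn
  rw [← setIntegral_eq_integral_of_forall_compl_eq_zero
    (s := Icc (fun _ => -R) fun _ => R), hbox]
  · refine Finset.sum_eq_zero fun i _ => ?_
    simp [hface i R (abs_of_pos hR0), hface i (-R) (by simp [abs_of_pos hR0])]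
  · intro x hx
    have hxR : R ≤ ‖x‖ := by
      contrapose! hx
      have hcoord := fun j => abs_le.1 ((norm_le_pi_norm x j).trans hx.le)
      exact ⟨fun j => (hcoord j).1, fun j => (hcoord j).2⟩
    refine Finset.sum_eq_zero fun i _ => ?_
    have : fderiv ℝ (X i) x = 0 := image_eq_zero_of_notMem_tsupport fun hmem =>
      hzero i x hxR (tsupport_fderiv_subset ℝ hmem)
    simp [this]

theorem sum_fderiv_sum_coord_smul_comp {F W ι κ : Type*} [NormedAddCommGroup F] [NormedSpace ℝ F]
    [NormedAddCommGroup W] [NormedSpace ℝ W] [Fintype ι] [DecidableEq ι] [Fintype κ]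
    (L : (ι → ℝ) ≃L[ℝ] F) {ψ : κ → F → W} (hd : ∀ j, Differentiable ℝ (ψ j)) (v : κ → F)
    (x : ι → ℝ) :
    ∑ i, fderiv ℝ (fun x => ∑ j, L.symm (v j) i • ψ j (L x)) x (Pi.single i 1) =
      ∑ j, fderiv ℝ (ψ j) (L x) (v j) := by
  have hcoord : ∀ i, fderiv ℝ (fun x => ∑ j, L.symm (v j) i • ψ j (L x)) x (Pi.single i 1) =
      ∑ j, L.symm (v j) i • fderiv ℝ (ψ j) (L x) (L (Pi.single i 1)) := fun i => by
    have hsum := HasFDerivAt.fun_sum (u := Finset.univ) fun j _ =>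
      (((hd j (L x)).hasFDerivAt.comp x L.hasFDerivAt).const_smul (L.symm (v j) i))
    rw [show fderiv ℝ (fun x => ∑ j, L.symm (v j) i • ψ j (L x)) x = _ from hsum.fderiv]
    simp
  simp_rw [hcoord]
  rw [Finset.sum_comm]
  refine Finset.sum_congr rfl fun j _ => ?_
  simp_rw [← map_smul, ← map_sum]
  rw [← pi_eq_sum_univ' (L.symm (v j)), L.apply_symm_apply]

theorem integral_sum_fderiv_eq_zero {F W κ : Type*} [NormedAddCommGroup F] [NormedSpace ℝ F]
    [FiniteDimensional ℝ F] [MeasurableSpace F] [BorelSpace F] (μ : Measure F)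
    [μ.IsAddHaarMeasure] [NormedAddCommGroup W] [NormedSpace ℝ W] [Fintype κ]
    (ψ : κ → F → W) (v : κ → F) (hd : ∀ j, Differentiable ℝ (ψ j))
    (hc : ∀ j, HasCompactSupport (ψ j))
    (hi : Integrable (fun y => ∑ j, fderiv ℝ (ψ j) y (v j)) μ) :
    ∫ y, ∑ j, fderiv ℝ (ψ j) y (v j) ∂μ = 0 := by
  rcases hn : Module.finrank ℝ F with _ | n
  · have := Module.finrank_zero_iff.1 hn
    simp [Subsingleton.elim _ (0 : F)]
  let L : (Fin (n + 1) → ℝ) ≃L[ℝ] F := ContinuousLinearEquiv.ofFinrankEq (by simp [hn])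
  have hemb : MeasurableEmbedding L.symm := L.symm.toHomeomorph.measurableEmbedding
  have : (μ.map L.symm).IsAddHaarMeasure := L.symm.isAddHaarMeasure_map μ
  have hvol := Measure.isAddLeftInvariant_eq_smul (volume : Measure (Fin (n + 1) → ℝ))
    (μ.map L.symm)
  set c := (volume : Measure (Fin (n + 1) → ℝ)).addHaarScalarFactor (μ.map L.symm)
  have hc0 : c ≠ 0 := (Measure.addHaarScalarFactor_pos_of_isAddHaarMeasure _ _).ne'
  let X : Fin (n + 1) → (Fin (n + 1) → ℝ) → W := fun i x => ∑ j, L.symm (v j) i • ψ j (L x)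
  have hdiv : ∀ x, ∑ i, fderiv ℝ (X i) x (Pi.single i 1) = ∑ j, fderiv ℝ (ψ j) (L x) (v j) :=
    sum_fderiv_sum_coord_smul_comp L hd v
  have hmap : ∫ y, ∑ j, fderiv ℝ (ψ j) y (v j) ∂μ
      = ∫ x, ∑ i, fderiv ℝ (X i) x (Pi.single i 1) ∂(μ.map L.symm) := by
    rw [hemb.integral_map]
    simp_rw [hdiv, L.apply_symm_apply]
  have hX := integral_divergence_eq_zero X (fun i => by fun_prop) (fun i => ?_) ?_
  · rw [hvol, integral_smul_nnreal_measure, smul_eq_zero] at hX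
    rw [hmap]
    exact hX.resolve_left hc0
  · refine HasCompactSupport.intro (isCompact_iUnion fun j =>
      (hc j).comp_homeomorph L.toHomeomorph) fun x hx => Finset.sum_eq_zero fun j _ => ?_
    have : (ψ j ∘ L.toHomeomorph) x = 0 := image_eq_zero_of_notMem_tsupport fun hmem =>
      hx (mem_iUnion_of_mem j hmem)
    exact smul_eq_zero_of_right _ this
  · rw [hvol]
    refine Integrable.smul_measure_nnreal (hemb.integrable_map_iff.2 ?_)
    simpa only [Function.comp_def, hdiv, L.apply_symm_apply] using hi

section NewtonKernel

open Module

variable {F : Type*} [NormedAddCommGroup F] [InnerProductSpace ℝ F]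

/-- The gradient of the Newtonian potential of `F`, smoothed by `ε` and up to a constant factor:
`newtonField 0 y = y / |y|ᴺ` with `N = dim F`. -/
noncomputable def newtonField (ε : ℝ) (y : F) : F :=
  (‖y‖ ^ 2 + ε) ^ (-(finrank ℝ F / 2 : ℝ)) • y

/-- The divergence of `newtonField ε`: up to its total mass, an approximate identity as `ε → 0`. -/
noncomputable def newtonDiv (ε : ℝ) (y : F) : ℝ :=
  finrank ℝ F * ε * (‖y‖ ^ 2 + ε) ^ (-(finrank ℝ F / 2 : ℝ) - 1)

theorem fderiv_newtonField_apply {ε : ℝ} {y : F} (h : 0 < ‖y‖ ^ 2 + ε) (v : F) :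
    fderiv ℝ (newtonField ε) y v = (‖y‖ ^ 2 + ε) ^ (-(finrank ℝ F / 2 : ℝ)) • v -
      (finrank ℝ F * (‖y‖ ^ 2 + ε) ^ (-(finrank ℝ F / 2 : ℝ) - 1) * inner ℝ y v) • y := by
  have hsq : HasFDerivAt (fun y : F => ‖y‖ ^ 2 + ε) (2 • innerSL ℝ y) y :=
    (hasStrictFDerivAt_norm_sq y).hasFDerivAt.add_const ε
  have hpow := hsq.rpow_const (p := -(finrank ℝ F / 2 : ℝ)) (Or.inl h.ne')
  have hfield : HasFDerivAt (newtonField ε) _ y := hpow.smul (hasFDerivAt_id y)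
  rw [hfield.fderiv]
  simp only [add_apply, smul_apply, ContinuousLinearMap.smulRight_apply, innerSL_apply_apply,
    ContinuousLinearMap.coe_id', id_eq]
  module

theorem inner_fderiv_newtonField_comm {ε : ℝ} {y : F} (h : 0 < ‖y‖ ^ 2 + ε) (v w : F) :
    inner ℝ w (fderiv ℝ (newtonField ε) y v) = inner ℝ v (fderiv ℝ (newtonField ε) y w) := by
  simp only [fderiv_newtonField_apply h, inner_sub_right, real_inner_smul_right]
  rw [real_inner_comm v w, real_inner_comm y v, real_inner_comm y w]
  ring

theorem sum_inner_fderiv_newtonField {ι : Type*} [Fintype ι] (b : OrthonormalBasis ι ℝ F) {ε : ℝ}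
    {y : F} (h : 0 < ‖y‖ ^ 2 + ε) :
    ∑ i, inner ℝ (b i) (fderiv ℝ (newtonField ε) y (b i)) = newtonDiv ε y := by
  have hparseval : ∑ i, inner ℝ y (b i) * inner ℝ (b i) y = ‖y‖ ^ 2 := by
    rw [b.sum_inner_mul_inner, real_inner_self_eq_norm_sq]
  have hpow : (‖y‖ ^ 2 + ε) ^ (-(finrank ℝ F / 2 : ℝ)) =
      (‖y‖ ^ 2 + ε) ^ (-(finrank ℝ F / 2 : ℝ) - 1) * (‖y‖ ^ 2 + ε) := by
    rw [← Real.rpow_add_one h.ne', sub_add_cancel]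
  simp only [fderiv_newtonField_apply h, inner_sub_right, real_inner_smul_right,
    b.inner_eq_one, mul_assoc, Finset.sum_sub_distrib, ← Finset.mul_sum, hparseval,
    Finset.sum_const, Finset.card_univ, ← finrank_eq_card_basis b.toBasis, nsmul_eq_mul, newtonDiv]
  rw [hpow]
  ring

theorem contDiff_newtonField {ε : ℝ} (hε : 0 < ε) {k : WithTop ℕ∞} :
    ContDiff ℝ k (newtonField ε : F → F) :=
  ContDiff.smul (ContDiff.rpow_const_of_ne ((contDiff_norm_sq ℝ).add contDiff_const)
    fun y => by positivity) contDiff_id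

theorem continuous_newtonDiv {ε : ℝ} (hε : 0 < ε) : Continuous (newtonDiv ε : F → ℝ) :=
  continuous_const.mul (Continuous.rpow_const (by fun_prop) fun y => Or.inl (by positivity))

theorem hasFDerivAt_clm_newtonField_smul {W : Type*} [NormedAddCommGroup W] [NormedSpace ℝ W]
    {ε : ℝ} (hε : 0 < ε) {Φ : F → W} {z : F} (hΦ : DifferentiableAt ℝ Φ z) (l : F →L[ℝ] ℝ)
    (B : W →L[ℝ] W) :
    HasFDerivAt (fun z => l (newtonField ε z) • B (Φ z)) (l (newtonField ε z) • B ∘L fderiv ℝ Φ z +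
      (l ∘L fderiv ℝ (newtonField ε) z).smulRight (B (Φ z))) z :=
  (l.hasFDerivAt.comp z ((contDiff_newtonField hε).differentiable one_ne_zero z).hasFDerivAt).smul
    (B.hasFDerivAt.comp z hΦ.hasFDerivAt)

theorem norm_newtonField_le {ε : ℝ} (hε : 0 ≤ ε) (y : F) :
    ‖newtonField ε y‖ ≤ ‖y‖ ^ (1 - finrank ℝ F : ℝ) := by
  rcases eq_or_ne y 0 with rfl | hy
  · simpa [newtonField] using Real.rpow_nonneg le_rfl _
  have hpos : 0 < ‖y‖ := norm_pos_iff.2 hy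
  calc ‖newtonField ε y‖ = (‖y‖ ^ 2 + ε) ^ (-(finrank ℝ F / 2 : ℝ)) * ‖y‖ := by
        rw [newtonField, norm_smul, Real.norm_of_nonneg (by positivity)]
    _ ≤ (‖y‖ ^ 2) ^ (-(finrank ℝ F / 2 : ℝ)) * ‖y‖ := by
        refine mul_le_mul_of_nonneg_right (Real.rpow_le_rpow_of_nonpos (by positivity)
          (by linarith) (neg_nonpos.2 (by positivity))) hpos.le
    _ = ‖y‖ ^ (1 - finrank ℝ F : ℝ) := by
        rw [← Real.rpow_natCast_mul hpos.le, ← Real.rpow_add_one hpos.ne']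
        congr 1
        push_cast
        ring

theorem tendsto_newtonField_zero (y : F) :
    Tendsto (fun ε => newtonField ε y) (𝓝 0) (𝓝 (newtonField 0 y)) := by
  rcases eq_or_ne y 0 with rfl | hy
  · simp [newtonField]
  have hpos : ‖y‖ ^ 2 + 0 ≠ 0 := by simpa using hy
  exact (ContinuousAt.rpow_const (by fun_prop) (Or.inl hpos)).smul continuousAt_const

theorem newtonDiv_sq_smul {δ : ℝ} (hδ : 0 < δ) (z : F) :
    newtonDiv (δ ^ 2) (δ • z) = (δ ^ finrank ℝ F)⁻¹ * newtonDiv 1 z := by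
  have hsq : ‖δ • z‖ ^ 2 + δ ^ 2 = δ ^ 2 * (‖z‖ ^ 2 + 1) := by
    rw [norm_smul, Real.norm_of_nonneg hδ.le]
    ring
  have hpow : (δ ^ 2) ^ (-(finrank ℝ F / 2 : ℝ) - 1) = (δ ^ finrank ℝ F)⁻¹ * (δ ^ 2)⁻¹ := by
    rw [← Real.rpow_natCast_mul hδ.le, ← Real.rpow_natCast, ← Real.rpow_natCast,
      ← Real.rpow_neg hδ.le, ← Real.rpow_neg hδ.le, ← Real.rpow_add hδ]
    congr 1
    push_cast
    ring
  simp only [newtonDiv, hsq]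
  rw [Real.mul_rpow (by positivity) (by positivity), hpow]
  field_simp

section Measure

variable [FiniteDimensional ℝ F] [MeasurableSpace F] [BorelSpace F]

theorem stronglyMeasurable_newtonField (ε : ℝ) : StronglyMeasurable (newtonField ε : F → F) := by
  refine Measurable.stronglyMeasurable ?_
  unfold newtonField
  fun_prop

theorem locallyIntegrable_norm_rpow_one_sub_finrank [Nontrivial F] :
    LocallyIntegrable fun y : F => ‖y‖ ^ (1 - finrank ℝ F : ℝ) :=
  locallyIntegrable_of_norm_le_rpow (C := 1) (α := finrank ℝ F - 1)
    (by exact_mod_cast (finrank_pos : 0 < finrank ℝ F)) (by simp)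
    (Eventually.of_forall fun y => by
      rw [one_mul, Real.norm_of_nonneg (by positivity), neg_sub])
    (Measurable.aestronglyMeasurable (by fun_prop))

theorem locallyIntegrable_newtonField [Nontrivial F] :
    LocallyIntegrable (newtonField 0 : F → F) :=
  locallyIntegrable_norm_rpow_one_sub_finrank.mono
    (stronglyMeasurable_newtonField 0).aestronglyMeasurable
    (Eventually.of_forall fun y => (norm_newtonField_le le_rfl y).trans (le_abs_self _))

theorem integrable_newtonDiv_one : Integrable (newtonDiv 1 : F → ℝ) := by
  have := integrable_rpow_neg_one_add_norm_sq (E := F) (μ := volume)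
    (r := finrank ℝ F + 2) (by simp)
  refine (this.const_mul (finrank ℝ F : ℝ)).congr (Eventually.of_forall fun y => ?_)
  simp only [newtonDiv, mul_one, add_comm (1 : ℝ)]
  congr 2
  ring

variable (F) in
/-- The total mass of the approximate identity `newtonDiv`, the constant in the Cauchy–Pompeiu
formula. -/
noncomputable def newtonMass : ℝ :=
  ∫ y : F, newtonDiv 1 y

theorem newtonMass_pos [Nontrivial F] : 0 < newtonMass F := by
  have hN : (0 : ℝ) < finrank ℝ F := Nat.cast_pos.2 finrank_pos
  have hpos : ∀ y : F, 0 < newtonDiv 1 y := fun y => by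
    unfold newtonDiv
    positivity
  refine (integral_pos_iff_support_of_nonneg (fun y => (hpos y).le) integrable_newtonDiv_one).2 ?_
  rw [Function.support_eq_univ fun y => (hpos y).ne']
  exact Measure.measure_univ_pos.2 (NeZero.ne _)

theorem integral_newtonDiv_sq_smul {W : Type*} [NormedAddCommGroup W] [NormedSpace ℝ W] {δ : ℝ}
    (hδ : 0 < δ) (g : F → W) :
    ∫ y, newtonDiv (δ ^ 2) y • g y = ∫ z, newtonDiv 1 z • g (δ • z) := by
  have hscale := Measure.integral_comp_smul (volume : Measure F)
    (fun y => newtonDiv (δ ^ 2) y • g y) δ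
  have hδN : 0 < δ ^ finrank ℝ F := by positivity
  simp only [newtonDiv_sq_smul hδ, mul_smul, integral_smul] at hscale
  rw [abs_of_pos (inv_pos.2 hδN)] at hscale
  exact (smul_right_injective W (inv_pos.2 hδN).ne' hscale).symm

theorem tendsto_integral_newtonDiv_sq_smul {W : Type*} [NormedAddCommGroup W] [NormedSpace ℝ W]
    [CompleteSpace W] {g : F → W} (hg : Continuous g) (hc : HasCompactSupport g) :
    Tendsto (fun δ : ℝ => ∫ y, newtonDiv (δ ^ 2) y • g y) (𝓝[>] 0)
      (𝓝 (newtonMass F • g 0)) := by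
  obtain ⟨M, hM⟩ := hg.bounded_above_of_compact_support hc
  have hdom : Tendsto (fun δ : ℝ => ∫ z : F, newtonDiv 1 z • g (δ • z)) (𝓝[>] 0)
      (𝓝 (∫ z : F, newtonDiv 1 z • g 0)) := by
    refine tendsto_integral_filter_of_dominated_convergence (fun z => ‖newtonDiv 1 z‖ * M)
      (Eventually.of_forall fun δ => integrable_newtonDiv_one.aestronglyMeasurable.smul
        (hg.comp (continuous_const_smul δ)).aestronglyMeasurable)
      (Eventually.of_forall fun δ => Eventually.of_forall fun z => ?_)
      (integrable_newtonDiv_one.norm.mul_const M)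
      (Eventually.of_forall fun z => Tendsto.const_smul ?_ _)
    · rw [norm_smul]
      gcongr
      exact hM _
    · have : Continuous fun δ : ℝ => g (δ • z) := by fun_prop
      simpa using (this.tendsto 0).mono_left (nhdsWithin_le_nhds (s := Ioi 0))
  rw [newtonMass, ← integral_smul_const]
  refine hdom.congr' ?_
  filter_upwards [self_mem_nhdsWithin] with δ hδ
  exact (integral_newtonDiv_sq_smul hδ g).symm

end Measure

end NewtonKernel

/-- A system `∂_t f = A_t ∂_{ℓ(t)} f` of Cauchy–Riemann type for functions `f : E → W`, where `∂_t`
is the derivative along the vector `vec t` and `A_t = coeff t`. The coefficients commute and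
`∑ A_t² = 0` over every block, a block being a fibre of `ℓ = lead`. -/
structure CRSystem (ι E W : Type*) [Fintype ι] [DecidableEq ι] [NormedAddCommGroup E]
    [NormedSpace ℝ E] [NormedAddCommGroup W] [NormedSpace ℝ W] where
  vec : ι → E
  linearIndependent : LinearIndependent ℝ vec
  lead : ι → ι
  coeff : ι → W →L[ℝ] W
  comm : ∀ s t, Commute (coeff s) (coeff t)
  sum_sq : ∀ b, ∑ t with lead t = b, coeff t ^ 2 = 0

namespace CRSystem

variable {ι E W : Type*} [Fintype ι] [DecidableEq ι] [NormedAddCommGroup E] [NormedSpace ℝ E]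
  [NormedAddCommGroup W] [NormedSpace ℝ W] (C : CRSystem ι E W)

/-- The antilinear part `(T v_t - A_t T v_{ℓ(t)})_t` of a linear map `T`: the system asks that it
vanish for the derivative. -/
noncomputable def antilinearPart : (E →L[ℝ] W) →L[ℝ] ι → W :=
  ContinuousLinearMap.pi fun t => ContinuousLinearMap.apply ℝ W (C.vec t) -
    C.coeff t ∘L ContinuousLinearMap.apply ℝ W (C.vec (C.lead t))

@[simp]
theorem antilinearPart_apply (T : E →L[ℝ] W) (t : ι) :
    C.antilinearPart T t = T (C.vec t) - C.coeff t (T (C.vec (C.lead t))) := rfl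

/-- The Cauchy–Riemann operator of the system. -/
noncomputable def dbar (f : E → W) (x : E) : ι → W :=
  C.antilinearPart (fderiv ℝ f x)

/-- The symbol of the conjugate operator `∑_t (∂_t + A_t ∂_{ℓ(t)})`, whose composition with `dbar`
is the Laplacian. -/
noncomputable def symbol : EuclideanSpace ℝ ι →L[ℝ] (ι → W) →L[ℝ] W :=
  let eval : ∀ _ : ι, (ι → W) →L[ℝ] W := ContinuousLinearMap.proj
  ∑ t, ((EuclideanSpace.proj t).smulRight (eval t) +
    (EuclideanSpace.proj (C.lead t)).smulRight (C.coeff t ∘L eval t))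

theorem symbol_apply (η : EuclideanSpace ℝ ι) (w : ι → W) :
    C.symbol η w = ∑ t, (η t • w t + η (C.lead t) • C.coeff t (w t)) := by
  simp [symbol]

theorem sum_coeff_coeff_lead (g : ι → W) : ∑ t, C.coeff t (C.coeff t (g (C.lead t))) = 0 := by
  rw [← Finset.sum_fiberwise Finset.univ C.lead]
  refine Finset.sum_eq_zero fun b _ => ?_
  calc ∑ t with C.lead t = b, C.coeff t (C.coeff t (g (C.lead t)))
      = ∑ t with C.lead t = b, (C.coeff t ^ 2) (g b) :=
        Finset.sum_congr rfl fun t ht => by rw [(Finset.mem_filter.1 ht).2, pow_two]; rfl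
    _ = 0 := by rw [← sum_apply, C.sum_sq, zero_apply]

theorem symbol_antilinearPart (η : EuclideanSpace ℝ ι) (T : E →L[ℝ] W) :
    C.symbol η (C.antilinearPart T) =
      ∑ t, (η t • C.antilinearPart T t + η (C.lead t) • C.coeff t (T (C.vec t))) := by
  have hsq := C.sum_coeff_coeff_lead fun b => η b • T (C.vec b)
  simp only [map_smul] at hsq
  rw [symbol_apply, ← sub_zero (∑ t, (_ + _ • C.coeff t (T _))), ← hsq, ← Finset.sum_sub_distrib]
  refine Finset.sum_congr rfl fun t _ => ?_
  rw [C.antilinearPart_apply, map_sub, smul_sub (η (C.lead t)), add_sub_assoc]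

/-- The parametrization `z ↦ ∑ z_t v_t` of the span of the vectors of the system. -/
noncomputable def ofCoord : EuclideanSpace ℝ ι →L[ℝ] E :=
  ∑ t, (EuclideanSpace.proj t).smulRight (C.vec t)

theorem ofCoord_apply (z : EuclideanSpace ℝ ι) : C.ofCoord z = ∑ t, z t • C.vec t := by
  simp [ofCoord]

@[simp]
theorem ofCoord_single (t : ι) : C.ofCoord (EuclideanSpace.single t 1) = C.vec t := by
  simp [ofCoord_apply]

theorem ofCoord_injective : Function.Injective C.ofCoord := by
  refine (injective_iff_map_eq_zero _).2 fun z hz => ?_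
  rw [ofCoord_apply] at hz
  ext t
  exact Fintype.linearIndependent_iff.1 C.linearIndependent _ hz t

theorem isClosedEmbedding_sub_ofCoord (x : E) :
    IsClosedEmbedding fun z => x - C.ofCoord z :=
  (Homeomorph.subLeft x).isClosedEmbedding.comp
    (LinearMap.isClosedEmbedding_of_injective (f := C.ofCoord.toLinearMap)
      (LinearMap.ker_eq_bot.2 C.ofCoord_injective))

/-- The potential with the kernel `symbol (y / |y|ᴺ)`, integrated over the directions of the system
only. By the Cauchy–Pompeiu formula it inverts `dbar`, up to the factor `newtonMass`. -/
noncomputable def pot (h : E → ι → W) (x : E) : W :=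
  ∫ z, C.symbol (newtonField 0 z) (h (x - C.ofCoord z))

theorem hasCompactSupport_dbar {φ : E → W} (hφ : HasCompactSupport φ) :
    HasCompactSupport (C.dbar φ) :=
  (hφ.fderiv ℝ).comp_left (map_zero C.antilinearPart)

section CauchyPompeiu

variable {φ : E → W}

theorem fderiv_comp_sub_ofCoord (hd : Differentiable ℝ φ) (x : E) (z v : EuclideanSpace ℝ ι) :
    fderiv ℝ (fun z => φ (x - C.ofCoord z)) z v = -fderiv ℝ φ (x - C.ofCoord z) (C.ofCoord v) := by
  have := (hd (x - C.ofCoord z)).hasFDerivAt.comp z (C.ofCoord.hasFDerivAt.const_sub x)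
  rw [show fderiv ℝ (fun z => φ (x - C.ofCoord z)) z = _ from this.fderiv]
  simp

/-- The fluxes `(k_t + k_{ℓ(t)} A_t) Φ` along `∂_t` and `-k_t A_t Φ` along `∂_{ℓ(t)}`, where `k` is
`newtonField ε`, whose total divergence is the integrand of Green's formula. -/
noncomputable def flux (ε : ℝ) (Φ : EuclideanSpace ℝ ι → W) : ι ⊕ ι → EuclideanSpace ℝ ι → W :=
  Sum.elim (fun t z => newtonField ε z t • Φ z + newtonField ε z (C.lead t) • C.coeff t (Φ z))
    (fun t z => -(newtonField ε z t • C.coeff t (Φ z)))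

theorem hasFDerivAt_flux_inl {ε : ℝ} (hε : 0 < ε) {Φ : EuclideanSpace ℝ ι → W}
    {z : EuclideanSpace ℝ ι} (hΦ : DifferentiableAt ℝ Φ z) (t : ι) :
    HasFDerivAt (C.flux ε Φ (.inl t))
      (newtonField ε z t • fderiv ℝ Φ z +
        (EuclideanSpace.proj t ∘L fderiv ℝ (newtonField ε) z).smulRight (Φ z) +
        (newtonField ε z (C.lead t) • C.coeff t ∘L fderiv ℝ Φ z +
          (EuclideanSpace.proj (C.lead t) ∘L fderiv ℝ (newtonField ε) z).smulRight
            (C.coeff t (Φ z)))) z :=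
  (hasFDerivAt_clm_newtonField_smul hε hΦ (EuclideanSpace.proj t) (.id ℝ W)).add
    (hasFDerivAt_clm_newtonField_smul hε hΦ (EuclideanSpace.proj (C.lead t)) (C.coeff t))

theorem hasFDerivAt_flux_inr {ε : ℝ} (hε : 0 < ε) {Φ : EuclideanSpace ℝ ι → W}
    {z : EuclideanSpace ℝ ι} (hΦ : DifferentiableAt ℝ Φ z) (t : ι) :
    HasFDerivAt (C.flux ε Φ (.inr t))
      (-(newtonField ε z t • C.coeff t ∘L fderiv ℝ Φ z +
        (EuclideanSpace.proj t ∘L fderiv ℝ (newtonField ε) z).smulRight (C.coeff t (Φ z)))) z :=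
  (hasFDerivAt_clm_newtonField_smul hε hΦ (EuclideanSpace.proj t) (C.coeff t)).neg

theorem differentiable_flux {ε : ℝ} (hε : 0 < ε) {Φ : EuclideanSpace ℝ ι → W}
    (hΦ : Differentiable ℝ Φ) : ∀ j, Differentiable ℝ (C.flux ε Φ j)
  | .inl t => fun z => (C.hasFDerivAt_flux_inl hε (hΦ z) t).differentiableAt
  | .inr t => fun z => (C.hasFDerivAt_flux_inr hε (hΦ z) t).differentiableAt

theorem hasCompactSupport_flux {ε : ℝ} {Φ : EuclideanSpace ℝ ι → W} (hΦ : HasCompactSupport Φ)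
    (j : ι ⊕ ι) : HasCompactSupport (C.flux ε Φ j) :=
  hΦ.mono fun z hz h0 => hz (by rcases j with t | t <;> simp [flux, h0])

theorem sum_fderiv_flux {ε : ℝ} (hε : 0 < ε) {Φ : EuclideanSpace ℝ ι → W}
    {z : EuclideanSpace ℝ ι} (hΦ : DifferentiableAt ℝ Φ z) :
    ∑ j, fderiv ℝ (C.flux ε Φ j) z (EuclideanSpace.single (Sum.elim id C.lead j) 1) =
      newtonDiv ε z • Φ z + ∑ t, (newtonField ε z t •
        (fderiv ℝ Φ z (EuclideanSpace.single t 1) -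
          C.coeff t (fderiv ℝ Φ z (EuclideanSpace.single (C.lead t) 1))) +
        newtonField ε z (C.lead t) • C.coeff t (fderiv ℝ Φ z (EuclideanSpace.single t 1))) := by
  have hsymm : ∀ s t, fderiv ℝ (newtonField ε) z (EuclideanSpace.single t 1) s =
      fderiv ℝ (newtonField ε) z (EuclideanSpace.single s 1) t := fun s t => by
    simpa [EuclideanSpace.inner_single_left] using inner_fderiv_newtonField_comm
      (by positivity : 0 < ‖z‖ ^ 2 + ε) (EuclideanSpace.single t 1) (EuclideanSpace.single s 1)
  have htrace : ∑ t, fderiv ℝ (newtonField ε) z (EuclideanSpace.single t 1) t =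
      newtonDiv ε z := by
    simpa [EuclideanSpace.inner_single_left] using
      sum_inner_fderiv_newtonField (EuclideanSpace.basisFun ι ℝ)
        (by positivity : 0 < ‖z‖ ^ 2 + ε)
  rw [Fintype.sum_sum_type, ← htrace, Finset.sum_smul, ← Finset.sum_add_distrib,
    ← Finset.sum_add_distrib]
  refine Finset.sum_congr rfl fun t _ => ?_
  rw [(C.hasFDerivAt_flux_inl hε hΦ t).fderiv, (C.hasFDerivAt_flux_inr hε hΦ t).fderiv]
  simp [hsymm t (C.lead t)]
  module

theorem integral_symbol_newtonField_dbar {ε : ℝ} (hε : 0 < ε) (hd : Differentiable ℝ φ)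
    (hc : HasCompactSupport φ) (hcont : Continuous (C.dbar φ)) (x : E) :
    ∫ z, C.symbol (newtonField ε z) (C.dbar φ (x - C.ofCoord z)) =
      ∫ z, newtonDiv ε z • φ (x - C.ofCoord z) := by
  let Φ : EuclideanSpace ℝ ι → W := fun z => φ (x - C.ofCoord z)
  have hsub : Differentiable ℝ fun z => x - C.ofCoord z := by fun_prop
  have hΦ : Differentiable ℝ Φ := hd.comp hsub
  have hΦc : HasCompactSupport Φ := hc.comp_isClosedEmbedding (C.isClosedEmbedding_sub_ofCoord x)
  have hdbarc : HasCompactSupport fun z => C.dbar φ (x - C.ofCoord z) :=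
    (C.hasCompactSupport_dbar hc).comp_isClosedEmbedding (C.isClosedEmbedding_sub_ofCoord x)
  have hleft : Integrable fun z => newtonDiv ε z • Φ z :=
    ((continuous_newtonDiv hε).smul hΦ.continuous).integrable_of_hasCompactSupport hΦc.smul_left
  have hright : Integrable fun z => C.symbol (newtonField ε z) (C.dbar φ (x - C.ofCoord z)) := by
    refine Continuous.integrable_of_hasCompactSupport ?_
      (hdbarc.mono fun z hz h0 => hz (by simp only [h0, map_zero]))
    exact (C.symbol.continuous.comp (contDiff_newtonField (k := 0) hε).continuous).clm_apply
      (hcont.comp hsub.continuous)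
  have hflux : ∀ z, ∑ j, fderiv ℝ (C.flux ε Φ j) z (EuclideanSpace.single (Sum.elim id C.lead j) 1)
      = newtonDiv ε z • Φ z - C.symbol (newtonField ε z) (C.dbar φ (x - C.ofCoord z)) := fun z => by
    rw [C.sum_fderiv_flux hε (hΦ z), dbar, symbol_antilinearPart, sub_eq_add_neg,
      ← Finset.sum_neg_distrib]
    simp only [Φ, C.fderiv_comp_sub_ofCoord hd, ofCoord_single, antilinearPart_apply, map_neg]
    congr 1
    exact Finset.sum_congr rfl fun t _ => by module
  have hgreen := integral_sum_fderiv_eq_zero volume (C.flux ε Φ)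
    (fun j => EuclideanSpace.single (Sum.elim id C.lead j) (1 : ℝ)) (C.differentiable_flux hε hΦ)
    (C.hasCompactSupport_flux hΦc) ((hleft.sub hright).congr (.of_forall fun z => (hflux z).symm))
  simp only [hflux, integral_sub hleft hright] at hgreen
  exact (sub_eq_zero.1 hgreen).symm

theorem tendsto_integral_symbol_newtonField [Nonempty ι] {h : E → ι → W} (hh : Continuous h)
    (hc : HasCompactSupport h) (x : E) :
    Tendsto (fun ε : ℝ => ∫ z, C.symbol (newtonField ε z) (h (x - C.ofCoord z))) (𝓝[≥] 0)
      (𝓝 (C.pot h x)) := by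
  have hcont : Continuous fun z => h (x - C.ofCoord z) := by fun_prop
  have hcs : HasCompactSupport fun z => h (x - C.ofCoord z) :=
    hc.comp_isClosedEmbedding (C.isClosedEmbedding_sub_ofCoord x)
  have hdom := (locallyIntegrable_norm_rpow_one_sub_finrank (F := EuclideanSpace ℝ ι))
    |>.integrable_smul_right_of_hasCompactSupport hcont.norm hcs.norm
  refine tendsto_integral_filter_of_dominated_convergence _ (.of_forall fun ε => ?_) ?_
    (hdom.const_mul ‖C.symbol‖) (.of_forall fun z => ?_)
  · exact C.symbol.aestronglyMeasurable_comp₂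
      (stronglyMeasurable_newtonField ε).aestronglyMeasurable hcont.aestronglyMeasurable
  · filter_upwards [self_mem_nhdsWithin] with ε hε
    refine .of_forall fun z => (C.symbol.le_opNorm₂ _ _).trans ?_
    rw [mul_assoc]
    gcongr
    exact mul_le_mul_of_nonneg_right (norm_newtonField_le hε z) (norm_nonneg _)
  · exact ((C.symbol.flip (h (x - C.ofCoord z))).continuous.tendsto _).comp
      ((tendsto_newtonField_zero z).mono_left nhdsWithin_le_nhds)

theorem pot_dbar [Nonempty ι] [CompleteSpace W] (hd : Differentiable ℝ φ)
    (hc : HasCompactSupport φ) (hcont : Continuous (C.dbar φ)) (x : E) :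
    C.pot (C.dbar φ) x = newtonMass (EuclideanSpace ℝ ι) • φ x := by
  have hsq : Tendsto (fun δ : ℝ => δ ^ 2) (𝓝[>] 0) (𝓝[≥] 0) :=
    tendsto_nhdsWithin_iff.2 ⟨((continuous_pow 2).tendsto' (0 : ℝ) 0 (by simp)).mono_left
      nhdsWithin_le_nhds, .of_forall fun δ => sq_nonneg δ⟩
  have hpot :=
    (C.tendsto_integral_symbol_newtonField hcont (C.hasCompactSupport_dbar hc) x).comp hsq
  have hmass := tendsto_integral_newtonDiv_sq_smul
    (g := fun z => φ (x - C.ofCoord z)) (hd.continuous.comp (by fun_prop))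
    (hc.comp_isClosedEmbedding (C.isClosedEmbedding_sub_ofCoord x))
  simp only [map_zero, sub_zero] at hmass
  refine tendsto_nhds_unique hpot (hmass.congr' ?_)
  filter_upwards [self_mem_nhdsWithin] with δ hδ
  have hδ0 : (0 : ℝ) < δ := hδ
  exact (C.integral_symbol_newtonField_dbar (by positivity) hd hc hcont x).symm

end CauchyPompeiu

end CRSystem

section Convolution

variable {F E V W X : Type*} [NormedAddCommGroup F] [MeasurableSpace F]
  [BorelSpace F] {μ : Measure F}
  [NormedAddCommGroup E] [NormedSpace ℝ E] [NormedAddCommGroup V] [NormedSpace ℝ V]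
  [NormedAddCommGroup W] [NormedSpace ℝ W] [NormedAddCommGroup X] [NormedSpace ℝ X]

theorem integrable_bilin_of_hasCompactSupport [SecondCountableTopology F]
    (B : X →L[ℝ] V →L[ℝ] W) {k : F → X} (hk : LocallyIntegrable k μ) {g : F → V}
    (hg : Continuous g) (hc : HasCompactSupport g) : Integrable (fun z => B (k z) (g z)) μ := by
  have hnorm : LocallyIntegrable (fun z => ‖k z‖) μ := fun x =>
    (hk x).imp fun s hs => hs.imp_right .norm
  have hbound := hnorm.integrable_smul_right_of_hasCompactSupport hg.norm hc.norm
  refine (hbound.const_mul ‖B‖).mono' (B.aestronglyMeasurable_comp₂ hk.aestronglyMeasurable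
    hg.aestronglyMeasurable) (.of_forall fun z => ?_)
  rw [smul_eq_mul, ← mul_assoc]
  exact B.le_opNorm₂ _ _

theorem hasFDerivAt_integral_clm_apply_sub [NormedSpace ℝ F] [FiniteDimensional ℝ F]
    {K : F → V →L[ℝ] W} (hK : LocallyIntegrable K μ) (L : F →L[ℝ] E) (hL : Function.Injective L)
    {h : E → V} (hh : ContDiff ℝ 1 h) (hc : HasCompactSupport h) (x : E) :
    HasFDerivAt (fun x => ∫ z, K z (h (x - L z)) ∂μ)
      (∫ z, K z ∘L fderiv ℝ h (x - L z) ∂μ) x := by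
  have hcont : Continuous (fderiv ℝ h) := hh.continuous_fderiv one_ne_zero
  obtain ⟨M, hM⟩ := (hc.fderiv ℝ).exists_bound_of_continuous hcont
  obtain ⟨c, -, hLc⟩ := L.toLinearMap.exists_antilipschitzWith (LinearMap.ker_eq_bot.2 hL)
  obtain ⟨R, hR⟩ := (hLc.isBounded_preimage
    ((isBounded_ball (x := x) (r := 1)).sub hc.isCompact.isBounded)).subset_closedBall 0
  have hzero : ∀ x' ∈ ball x 1, ∀ z ∉ closedBall 0 R, fderiv ℝ h (x' - L z) = 0 :=
    fun x' hx' z hz => by_contra fun hne => hz (hR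
      ⟨x', hx', _, support_fderiv_subset ℝ hne, sub_sub_cancel x' (L z)⟩)
  have hint : ∀ x', Integrable (fun z => K z (h (x' - L z))) μ := fun x' =>
    integrable_bilin_of_hasCompactSupport (.id ℝ _) hK (hh.continuous.comp (by fun_prop))
      (hc.comp_isClosedEmbedding ((Homeomorph.subLeft x').isClosedEmbedding.comp
        (LinearMap.isClosedEmbedding_of_injective (f := L.toLinearMap)
          (LinearMap.ker_eq_bot.2 hL))))
  refine hasFDerivAt_integral_of_dominated_of_fderiv_le
    (F' := fun x' z => K z ∘L fderiv ℝ h (x' - L z))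
    (bound := (closedBall 0 R).indicator fun z => ‖K z‖ * M) (ball_mem_nhds x one_pos)
    (.of_forall fun x' => (hint x').aestronglyMeasurable) (hint x)
    ((ContinuousLinearMap.compL ℝ E V W).aestronglyMeasurable_comp₂ hK.aestronglyMeasurable
      (by fun_prop : Continuous fun z => fderiv ℝ h (x - L z)).aestronglyMeasurable)
    (.of_forall fun z x' hx' => ?_)
    (IntegrableOn.integrable_indicator
      ((hK.integrableOn_isCompact (isCompact_closedBall 0 R)).norm.mul_const M)
      isClosed_closedBall.measurableSet) (.of_forall fun z x' _ => ?_)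
  · by_cases hz : z ∈ closedBall 0 R
    · rw [indicator_of_mem hz]
      exact (ContinuousLinearMap.opNorm_comp_le _ _).trans (by gcongr; exact hM _)
    · simp [hz, hzero x' hx' z hz]
  · exact (K z).hasFDerivAt.comp x'
      ((hh.differentiable one_ne_zero _).hasFDerivAt.comp x' ((hasFDerivAt_id x').sub_const (L z)))

end Convolution

namespace CRSystem

variable {ι κ E W : Type*} [Fintype ι] [DecidableEq ι] [Fintype κ] [DecidableEq κ]
  [NormedAddCommGroup E] [NormedSpace ℝ E]
  [NormedAddCommGroup W] [NormedSpace ℝ W] (C : CRSystem ι E W) (D : CRSystem κ E W)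

theorem symbol_comp_of_commute {A : W →L[ℝ] W} (hA : ∀ t, Commute A (C.coeff t))
    (η : EuclideanSpace ℝ ι) (w : ι → W) : C.symbol η (fun t => A (w t)) = A (C.symbol η w) := by
  have hA' : ∀ t u, C.coeff t (A u) = A (C.coeff t u) := fun t u =>
    (DFunLike.congr_fun (hA t) u).symm
  simp [symbol_apply, hA']

theorem locallyIntegrable_symbol_newtonField [Nonempty ι] :
    LocallyIntegrable fun z => C.symbol (newtonField 0 z) := fun x =>
  C.symbol.integrableAtFilter_comp (locallyIntegrable_newtonField x)

theorem hasFDerivAt_pot [Nonempty ι] {h : E → ι → W} (hh : ContDiff ℝ 1 h)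
    (hc : HasCompactSupport h) (x : E) :
    HasFDerivAt (C.pot h)
      (∫ z, C.symbol (newtonField 0 z) ∘L fderiv ℝ h (x - C.ofCoord z)) x :=
  hasFDerivAt_integral_clm_apply_sub C.locallyIntegrable_symbol_newtonField C.ofCoord
    C.ofCoord_injective hh hc x

theorem dbar_pot_apply [Nonempty κ] [CompleteSpace W]
    (hCD : ∀ s t, Commute (C.coeff s) (D.coeff t)) {h : E → κ → W} (hh : ContDiff ℝ 1 h)
    (hc : HasCompactSupport h) (x : E) (s : ι) :
    C.dbar (D.pot h) x s = D.pot (fun y t => C.dbar (fun y => h y t) y s) x := by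
  have hint : Integrable fun z =>
      D.symbol (newtonField 0 z) ∘L fderiv ℝ h (x - D.ofCoord z) :=
    integrable_bilin_of_hasCompactSupport (ContinuousLinearMap.compL ℝ E (κ → W) W)
      D.locallyIntegrable_symbol_newtonField
      ((hh.continuous_fderiv one_ne_zero).comp (by fun_prop))
      ((hc.fderiv ℝ).comp_isClosedEmbedding (D.isClosedEmbedding_sub_ofCoord x))
  rw [dbar, (D.hasFDerivAt_pot hh hc x).fderiv]
  have hcomm := (ContinuousLinearMap.proj (φ := fun _ : ι => W) s ∘L
    C.antilinearPart).integral_comp_comm hint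
  refine hcomm.symm.trans (integral_congr_ae (.of_forall fun z => ?_))
  have hfderiv : ∀ t v, fderiv ℝ (fun y => h y t) (x - D.ofCoord z) v =
      fderiv ℝ h (x - D.ofCoord z) v t := fun t v => by
    rw [fderiv_apply (hh.differentiable one_ne_zero _)]
    rfl
  simp only [ContinuousLinearMap.comp_apply, ContinuousLinearMap.proj_apply, dbar,
    antilinearPart_apply, hfderiv]
  rw [← D.symbol_comp_of_commute (hCD s), ← map_sub]
  rfl

/-- The subsystem of a block, which differentiates along the vectors of the block only. -/
def block {b : ι} (hb : C.lead b = b) : CRSystem {t // C.lead t = b} E W where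
  vec t := C.vec t
  linearIndependent := C.linearIndependent.comp _ Subtype.val_injective
  lead _ := ⟨b, hb⟩
  coeff t := C.coeff t
  comm s t := C.comm s t
  sum_sq b' := by
    by_cases h : ⟨b, hb⟩ = b'
    · simp only [h, Finset.filter_true]
      rw [← C.sum_sq b]
      exact (Finset.sum_subtype (p := fun t => C.lead t = b) _ (by simp)
        fun t => C.coeff t ^ 2).symm
    · simp [h]

theorem dbar_block {b : ι} (hb : C.lead b = b) (f : E → W) (x : E) (t : {t // C.lead t = b}) :
    (C.block hb).dbar f x t = C.dbar f x t := by
  simp [dbar, block, t.2]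

theorem dbar_pot_block [CompleteSpace W] {b : ι} (hb : C.lead b = b) {h : E → ι → W}
    (hh : ContDiff ℝ 1 h) (hc : HasCompactSupport h)
    (hclosed : ∀ x s t, C.dbar (fun y => h y t) x s = C.dbar (fun y => h y s) x t) (x : E) :
    C.dbar ((C.block hb).pot fun y t => h y t) x =
      newtonMass (EuclideanSpace ℝ {t // C.lead t = b}) • h x := by
  have : Nonempty {t // C.lead t = b} := ⟨⟨b, hb⟩⟩
  ext s
  have hhs := contDiff_pi.1 hh s
  rw [C.dbar_pot_apply (C.block hb) (fun s t => C.comm s t) (h := fun y t => h y t.1) (by fun_prop)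
    (hc.comp_left (g := fun (w : ι → W) (t : {t // C.lead t = b}) => w t) rfl)]
  simp only [hclosed _ s, ← C.dbar_block hb]
  exact (C.block hb).pot_dbar (hhs.differentiable one_ne_zero)
    (hc.comp_left (g := fun w : ι → W => w s) rfl)
    ((C.block hb).antilinearPart.continuous.comp (hhs.continuous_fderiv one_ne_zero)) x

theorem pot_eq_zero {l : E →L[ℝ] ℝ} (hl : ∀ t, l (C.vec t) = 0) {h : E → ι → W} {x : E}
    (hx : l x ∉ l '' tsupport h) : C.pot h x = 0 := by
  have hzero : ∀ z, h (x - C.ofCoord z) = 0 := fun z =>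
    image_eq_zero_of_notMem_tsupport fun hmem => hx ⟨_, hmem, by simp [ofCoord_apply, hl]⟩
  simp [pot, hzero]

end CRSystem

section Analyticity

theorem exists_analyticAt_exp_rightInverse {A : Type*} [NormedCommRing A] [NormedAlgebra ℝ A]
    [CompleteSpace A] (u : A) :
    ∃ Λ : A → A, AnalyticAt ℝ Λ (NormedSpace.exp u) ∧
      ∀ᶠ v in 𝓝 (NormedSpace.exp u), NormedSpace.exp (Λ v) = v := by
  let _ := NormedAlgebra.restrictScalars ℚ ℝ A
  let e : A ≃L[ℝ] A := ContinuousLinearEquiv.smulLeft (NormedSpace.isUnit_exp u).unit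
  have he : HasStrictFDerivAt NormedSpace.exp (e : A →L[ℝ] A) u :=
    (hasStrictFDerivAt_exp (𝕂 := ℝ)).congr_fderiv (by ext; rfl)
  have hexp : ContDiffAt ℝ ω NormedSpace.exp u := (NormedSpace.exp_analytic u).contDiffAt
  exact ⟨_, (hexp.to_localInverse he.hasFDerivAt (by simp)).analyticAt, he.eventually_right_inverse⟩

theorem exists_analyticAt_rpow {K : Type*} [TopologicalSpace K] [CompactSpace K] {u : C(K, ℝ)}
    (hu : ∀ y, 0 < u y) (α : ℝ) :
    ∃ Φ : C(K, ℝ) → C(K, ℝ), AnalyticAt ℝ Φ u ∧ ∀ᶠ v in 𝓝 u, ∀ y, Φ v y = v y ^ α := by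
  obtain ⟨l, rfl⟩ : ∃ l : C(K, ℝ), NormedSpace.exp l = u :=
    ⟨⟨fun y => Real.log (u y), u.continuous.log fun y => (hu y).ne'⟩, by
      ext y; simp [NormedSpace.exp_continuousMap_eq, ← Real.exp_eq_exp_ℝ, Real.exp_log (hu y)]⟩
  obtain ⟨Λ, hΛ, hexp⟩ := exists_analyticAt_exp_rightInverse l
  refine ⟨fun v => NormedSpace.exp (α • Λ v),
    (NormedSpace.exp_analytic _).comp (hΛ.const_smul (c := α)), ?_⟩
  filter_upwards [hexp] with v hv y
  have hvy : v y = Real.exp (Λ v y) := by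
    conv_lhs => rw [← hv]
    simp [NormedSpace.exp_continuousMap_eq, Real.exp_eq_exp_ℝ]
  rw [hvy, ← Real.exp_mul]
  simp [NormedSpace.exp_continuousMap_eq, Real.exp_eq_exp_ℝ, mul_comm]

variable {K F X W : Type*} [TopologicalSpace K] [CompactSpace K] [MeasurableSpace K] [BorelSpace K]
  (ν : Measure K) [IsFiniteMeasure ν] [NormedAddCommGroup F]
  [InnerProductSpace ℝ F] [FiniteDimensional ℝ F]
  [NormedAddCommGroup X] [NormedSpace ℝ X] [NormedAddCommGroup W] [NormedSpace ℝ W]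

/-- The weighted integral `a ↦ ∫ a g` of continuous functions on a compact space. -/
noncomputable def integralSMulCLM (g : C(K, X)) : C(K, ℝ) →L[ℝ] X :=
  have hint : ∀ a : C(K, ℝ), Integrable (fun y => a y • g y) ν := fun a =>
    (a.continuous.smul g.continuous).integrable_of_hasCompactSupport (.of_compactSpace _)
  LinearMap.mkContinuous
    { toFun a := ∫ y, a y • g y ∂ν
      map_add' a b := by
        simp only [ContinuousMap.add_apply, add_smul, integral_add (hint a) (hint b)]
      map_smul' c a := by simp [mul_smul, integral_smul] }
    (‖g‖ * ν.real univ) fun a => by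
      have hle : ∀ᵐ y ∂ν, ‖a y • g y‖ ≤ ‖a‖ * ‖g‖ := .of_forall fun y => by
        rw [norm_smul]
        gcongr
        exacts [a.norm_coe_le_norm y, g.norm_coe_le_norm y]
      calc ‖∫ y, a y • g y ∂ν‖ ≤ ‖a‖ * ‖g‖ * ν.real univ := norm_integral_le_of_norm_le_const hle
        _ = ‖g‖ * ν.real univ * ‖a‖ := by ring

theorem analyticAt_integral_rpow_smul {c : K → F} (hc : Continuous c) (g : C(K, X)) (α : ℝ) {w₀ : F}
    (hw₀ : w₀ ∉ range c) :
    AnalyticAt ℝ (fun w => ∫ y, (‖w - c y‖ ^ 2) ^ α • g y ∂ν) w₀ := by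
  let inn : F →L[ℝ] C(K, ℝ) := LinearMap.toContinuousLinearMap
    { toFun w := ⟨fun y => inner ℝ w (c y), by fun_prop⟩
      map_add' v w := by ext; simp [inner_add_left]
      map_smul' a w := by ext; simp [inner_smul_left] }
  let sq : C(K, ℝ) := ⟨fun y => ‖c y‖ ^ 2, by fun_prop⟩
  let Q : F → C(K, ℝ) := fun w => ‖w‖ ^ 2 • (1 : C(K, ℝ)) - (2 : ℝ) • inn w + sq
  have hQ : ∀ w y, Q w y = ‖w - c y‖ ^ 2 := fun w y => by simp [Q, sq, inn, norm_sub_sq_real]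
  have hQan : AnalyticAt ℝ Q w₀ := by
    have hsq : AnalyticAt ℝ (fun w : F => ‖w‖ ^ 2) w₀ := (contDiff_norm_sq ℝ).contDiffAt.analyticAt
    exact ((hsq.smul analyticAt_const).sub ((inn.analyticAt w₀).const_smul (c := (2 : ℝ)))).add
      analyticAt_const
  obtain ⟨Φ, hΦ, hpow⟩ := exists_analyticAt_rpow (u := Q w₀) (fun y => by
    have := sub_ne_zero.2 fun h => hw₀ ⟨y, h.symm⟩
    rw [hQ]; positivity) α
  refine (((integralSMulCLM ν g).analyticAt _).comp (hΦ.comp hQan)).congr ?_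
  filter_upwards [hQan.continuousAt.eventually hpow] with w hw
  simp [integralSMulCLM, hw, hQ]

theorem analyticAt_integral_newtonField [CompleteSpace X] [CompleteSpace W]
    (B : F →L[ℝ] X →L[ℝ] W) {c : K → F} (hc : Continuous c) (g : C(K, X)) {w₀ : F}
    (hw₀ : w₀ ∉ range c) :
    AnalyticAt ℝ (fun w => ∫ y, B (newtonField 0 (w - c y)) (g y) ∂ν) w₀ := by
  set α : ℝ := -(Module.finrank ℝ F / 2)
  let Bg : C(K, W) := ⟨fun y => B (c y) (g y), by fun_prop⟩
  have hB : AnalyticAt ℝ (fun w => B w (∫ y, (‖w - c y‖ ^ 2) ^ α • g y ∂ν)) w₀ :=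
    (B.analyticAt_bilinear _).comp₂ analyticAt_id (analyticAt_integral_rpow_smul ν hc g α hw₀)
  refine (hB.sub (analyticAt_integral_rpow_smul ν hc Bg α hw₀)).congr ?_
  filter_upwards [(isCompact_range hc).isClosed.isOpen_compl.mem_nhds hw₀] with w hw
  have hq : Continuous fun y => (‖w - c y‖ ^ 2) ^ α :=
    Continuous.rpow_const (by fun_prop) fun y => .inl (by
      have := sub_ne_zero.2 fun h => hw ⟨y, h.symm⟩
      positivity)
  have hg : Integrable (fun y => (‖w - c y‖ ^ 2) ^ α • g y) ν :=
    (hq.smul g.continuous).integrable_of_hasCompactSupport (.of_compactSpace _)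
  have hBg : Integrable (fun y => (‖w - c y‖ ^ 2) ^ α • Bg y) ν :=
    (hq.smul Bg.continuous).integrable_of_hasCompactSupport (.of_compactSpace _)
  rw [Pi.sub_apply, ← (B w).integral_comp_comm hg, ← integral_sub ((B w).integrable_comp hg) hBg]
  simp [newtonField, Bg, α, smul_sub]

end Analyticity

theorem exists_contDiff_cutoff {E : Type*} [NormedAddCommGroup E] [NormedSpace ℝ E]
    [FiniteDimensional ℝ E] {K U : Set E} (hK : IsCompact K) (hU : IsOpen U) (hKU : K ⊆ U) :
    ∃ χ : E → ℝ, ContDiff ℝ ∞ χ ∧ HasCompactSupport χ ∧ tsupport χ ⊆ U ∧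
      ∀ x ∈ K, χ =ᶠ[𝓝 x] 1 := by
  obtain ⟨T, hT, hKT, hTU⟩ := exists_compact_between hK hU hKU
  obtain ⟨χ, hone, hzero, -⟩ := exists_contMDiffMap_one_nhds_of_subset_interior
    (n := ⊤) 𝓘(ℝ, E) hK.isClosed hKT
  have hsupp : Function.support χ ⊆ T := fun x hx => by_contra fun hxT => hx (hzero x hxT)
  exact ⟨χ, χ.contMDiff.contDiff, .of_support_subset_isCompact hT hsupp,
    (closure_minimal hsupp hT.isClosed).trans hTU, eventually_nhdsSet_iff_forall.1 hone⟩

namespace CRSystem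

variable {ι E W : Type*} [Fintype ι] [DecidableEq ι] [NormedAddCommGroup E] [NormedSpace ℝ E]
  [NormedAddCommGroup W] [NormedSpace ℝ W] (C : CRSystem ι E W)

/-- The coordinates with respect to the vectors of a system which span the whole space. -/
noncomputable def coordEquiv (hC : Function.Surjective C.ofCoord) : EuclideanSpace ℝ ι ≃L[ℝ] E :=
  (LinearEquiv.ofBijective C.ofCoord.toLinearMap ⟨C.ofCoord_injective, hC⟩).toContinuousLinearEquiv

theorem finiteDimensional (hC : Function.Surjective C.ofCoord) : FiniteDimensional ℝ E :=
  (C.coordEquiv hC).toLinearEquiv.finiteDimensional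

theorem pot_coordEquiv (hC : Function.Surjective C.ofCoord) (h : E → ι → W)
    (w : EuclideanSpace ℝ ι) :
    C.pot h (C.coordEquiv hC w) = ∫ y in C.coordEquiv hC ⁻¹' tsupport h,
      C.symbol (newtonField 0 (w - y)) (h (C.coordEquiv hC y)) := by
  have hcoord : ∀ z, C.coordEquiv hC w - C.ofCoord z = C.coordEquiv hC (w - z) := fun z =>
    (map_sub C.ofCoord w z).symm
  rw [setIntegral_eq_integral_of_forall_compl_eq_zero fun y hy => by
    simp [image_eq_zero_of_notMem_tsupport hy],
    ← integral_sub_left_eq_self (fun y => C.symbol (newtonField 0 (w - y)) _) volume w]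
  simp only [pot, hcoord, sub_sub_cancel]

theorem analyticAt_pot [CompleteSpace W] (hC : Function.Surjective C.ofCoord) {h : E → ι → W}
    (hh : Continuous h) (hc : HasCompactSupport h) {x : E} (hx : x ∉ tsupport h) :
    AnalyticAt ℝ (C.pot h) x := by
  let e := C.coordEquiv hC
  let K := e ⁻¹' tsupport h
  have hK : IsCompact K := e.toHomeomorph.isCompact_preimage.2 hc.isCompact
  have : CompactSpace K := isCompact_iff_compactSpace.1 hK
  let ν : Measure K := volume.comap Subtype.val
  have : IsFiniteMeasure ν :=
    ⟨by simpa [ν, comap_subtype_coe_apply hK.measurableSet] using hK.measure_lt_top⟩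
  have hpot : ∀ w, C.pot h (e w) = ∫ y, C.symbol (newtonField 0 (w - y)) (h (e y)) ∂ν := fun w =>
    (C.pot_coordEquiv hC h w).trans (integral_subtype_comap hK.measurableSet _).symm
  have hnot : e.symm x ∉ range ((↑) : K → EuclideanSpace ℝ ι) := by
    simpa [K] using hx
  have han := analyticAt_integral_newtonField ν C.symbol continuous_subtype_val
    ⟨fun y : K => h (e y), by fun_prop⟩ hnot
  refine (han.comp (e.symm.analyticAt x)).congr (.of_forall fun y => ?_)
  simpa using (hpot (e.symm y)).symm

/-- The commutator of `dbar` with the multiplication by `χ`, applied to `f`. -/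
noncomputable def cut (χ : E → ℝ) (f : E → W) (x : E) : ι → W :=
  C.antilinearPart ((fderiv ℝ χ x).smulRight (f x))

theorem dbar_smul {χ : E → ℝ} {f : E → W} {x : E} (hχ : DifferentiableAt ℝ χ x)
    (hf : DifferentiableAt ℝ f x) :
    C.dbar (fun y => χ y • f y) x = χ x • C.dbar f x + C.cut χ f x := by
  rw [dbar, fderiv_fun_smul hχ hf, map_add, map_smul, dbar, cut]

theorem tsupport_cut_subset (χ : E → ℝ) (f : E → W) :
    tsupport (C.cut χ f) ⊆ tsupport (fderiv ℝ χ) :=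
  closure_mono fun x hx h0 => hx (by simp [cut, h0])

theorem hasCompactSupport_cut {χ : E → ℝ} (hχ : HasCompactSupport χ) (f : E → W) :
    HasCompactSupport (C.cut χ f) :=
  (hχ.fderiv ℝ).mono fun x hx h0 => hx (by simp [cut, h0])

theorem contDiff_cut {χ : E → ℝ} {f : E → W} {n : ℕ∞} (hχ : ContDiff ℝ ∞ χ)
    (hf : ∀ x ∈ tsupport (fderiv ℝ χ), ContDiffAt ℝ n f x) : ContDiff ℝ n (C.cut χ f) := by
  refine contDiff_iff_contDiffAt.2 fun x => ?_
  by_cases hx : x ∈ tsupport (fderiv ℝ χ)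
  · have hχ' : ContDiff ℝ n (fderiv ℝ χ) := hχ.fderiv_right (by exact_mod_cast le_top)
    exact C.antilinearPart.contDiff.contDiffAt.comp x (hχ'.contDiffAt.smulRight (hf x hx))
  · exact (contDiffAt_const (c := 0)).congr_of_eventuallyEq (notMem_tsupport_iff_eventuallyEq.1
      fun hmem => hx (C.tsupport_cut_subset χ f hmem))

/-- `f` solves the system on `U`. -/
def IsSolOn (f : E → W) (U : Set E) : Prop :=
  ∀ x ∈ U, DifferentiableAt ℝ f x ∧ C.dbar f x = 0

variable {C} {f : E → W} {U : Set E}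

theorem IsSolOn.dbar_smul_cutoff (hf : C.IsSolOn f U) {χ : E → ℝ}
    (hχ : Differentiable ℝ χ) {x : E} (hx : x ∈ U) :
    C.dbar (fun y => χ y • f y) x = C.cut χ f x := by
  rw [C.dbar_smul (hχ x) (hf x hx).1, (hf x hx).2, smul_zero, zero_add]

theorem IsSolOn.continuous_cut (hf : C.IsSolOn f U) (hU : IsOpen U) {χ : E → ℝ}
    (hχ : ContDiff ℝ ∞ χ) (hχU : tsupport χ ⊆ U) : Continuous (C.cut χ f) := by
  have hcut : ContDiff ℝ (0 : ℕ∞) (C.cut χ f) := C.contDiff_cut hχ fun x hx =>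
    contDiffAt_zero.2 ⟨U, hU.mem_nhds (hχU (tsupport_fderiv_subset ℝ hx)),
      fun y hy => (hf y hy).1.continuousAt.continuousWithinAt⟩
  exact hcut.continuous

theorem IsSolOn.pot_cut [Nonempty ι] [CompleteSpace W] (hf : C.IsSolOn f U) (hU : IsOpen U)
    {χ : E → ℝ} (hχ : ContDiff ℝ ∞ χ) (hc : HasCompactSupport χ) (hχU : tsupport χ ⊆ U) (x : E) :
    C.pot (C.cut χ f) x = newtonMass (EuclideanSpace ℝ ι) • χ x • f x := by
  have hχ' : Differentiable ℝ χ := hχ.differentiable (by simp)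
  have hzero : ∀ x ∉ tsupport χ, (fun y => χ y • f y) =ᶠ[𝓝 x] 0 := fun x hx => by
    filter_upwards [notMem_tsupport_iff_eventuallyEq.1 hx] with y hy
    simp [hy]
  have hdbar : C.dbar (fun y => χ y • f y) = C.cut χ f := by
    ext1 x
    by_cases hx : x ∈ tsupport χ
    · exact hf.dbar_smul_cutoff hχ' (hχU hx)
    · rw [dbar, (hzero x hx).fderiv_eq, cut, fderiv_of_notMem_tsupport ℝ hx]
      simp
  have hd : Differentiable ℝ fun y => χ y • f y := fun x => by
    by_cases hx : x ∈ tsupport χ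
    · exact (hχ' x).smul (hf x (hχU hx)).1
    · exact (hzero x hx).differentiableAt_iff.2 (differentiableAt_const 0)
  rw [← hdbar]
  exact C.pot_dbar hd hc.smul_right (hdbar ▸ hf.continuous_cut hU hχ hχU) x

theorem IsSolOn.analyticOnNhd [Nonempty ι] [CompleteSpace W] (hf : C.IsSolOn f U)
    (hC : Function.Surjective C.ofCoord) (hU : IsOpen U) : AnalyticOnNhd ℝ f U := fun x hx => by
  have := C.finiteDimensional hC
  obtain ⟨χ, hχ, hχc, hχU, hχ1⟩ := exists_contDiff_cutoff isCompact_singleton hU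
    (singleton_subset_iff.2 hx)
  have hone : χ =ᶠ[𝓝 x] 1 := hχ1 x rfl
  have hnot : x ∉ tsupport (C.cut χ f) := by
    rw [notMem_tsupport_iff_eventuallyEq]
    filter_upwards [hone.fderiv (𝕜 := ℝ)] with y hy
    simp [cut, hy]
  have hpot :=
    C.analyticAt_pot hC (hf.continuous_cut hU hχ hχU) (C.hasCompactSupport_cut hχc f) hnot
  refine (hpot.const_smul (c := (newtonMass (EuclideanSpace ℝ ι))⁻¹)).congr ?_
  filter_upwards [hone] with y hy
  rw [Pi.smul_apply, hf.pot_cut hU hχ hχc hχU, hy, inv_smul_smul₀ newtonMass_pos.ne', Pi.one_apply,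
    one_smul]

end CRSystem

theorem exists_mem_frontier_forall_lt {E : Type*} [NormedAddCommGroup E] [NormedSpace ℝ E]
    [ProperSpace E] {l : E →L[ℝ] ℝ} (hl : l ≠ 0) {Ω : Set E} (hΩ : IsOpen Ω) (hne : Ω.Nonempty)
    (hb : IsBounded Ω) : ∃ x ∈ frontier Ω, ∀ y ∈ Ω, l y < l x := by
  obtain ⟨x, hx, hmax⟩ := hb.isCompact_closure.exists_isMaxOn hne.closure l.continuous.continuousOn
  have hlt : ∀ y ∈ Ω, l y < l x := fun y hy => by
    refine (hmax (subset_closure hy)).lt_of_ne fun heq => hl ?_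
    have hlocal : IsLocalMax l y := by
      filter_upwards [hΩ.mem_nhds hy] with z hz
      exact (hmax (subset_closure hz)).trans_eq heq.symm
    simpa using hlocal.fderiv_eq_zero
  exact ⟨x, ⟨hx, fun hint => (hlt x (interior_subset hint)).false⟩, hlt⟩

namespace CRSystem

variable {ι E W : Type*} [Fintype ι] [DecidableEq ι] [NormedAddCommGroup E] [NormedSpace ℝ E]
  [NormedAddCommGroup W] [NormedSpace ℝ W] {C : CRSystem ι E W}

theorem fderiv_dbar_apply (C : CRSystem ι E W) {g : E → W} {x : E} (hg : ContDiffAt ℝ 2 g x)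
    (t : ι) (v : E) :
    fderiv ℝ (fun y => C.dbar g y t) x v = fderiv ℝ (fderiv ℝ g) x v (C.vec t) -
      C.coeff t (fderiv ℝ (fderiv ℝ g) x v (C.vec (C.lead t))) := by
  have hd : HasFDerivAt (fderiv ℝ g) (fderiv ℝ (fderiv ℝ g) x) x :=
    ((hg.fderiv_right (m := 1) le_rfl).differentiableAt one_ne_zero).hasFDerivAt
  have hdbar := (ContinuousLinearMap.proj (φ := fun _ : ι => W) t ∘L
    C.antilinearPart).hasFDerivAt.comp x hd
  rw [show fderiv ℝ (fun y => C.dbar g y t) x = _ from hdbar.fderiv]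
  simp

theorem dbar_dbar_comm (C : CRSystem ι E W) {g : E → W} {x : E} (hg : ContDiffAt ℝ 2 g x)
    (s t : ι) :
    C.dbar (fun y => C.dbar g y t) x s = C.dbar (fun y => C.dbar g y s) x t := by
  have hsymm : ∀ v w, fderiv ℝ (fderiv ℝ g) x v w = fderiv ℝ (fderiv ℝ g) x w v :=
    (hg.isSymmSndFDerivAt (by simp)).eq
  have hcomm : ∀ w, C.coeff s (C.coeff t w) = C.coeff t (C.coeff s w) :=
    DFunLike.congr_fun (C.comm s t)
  rw [dbar, dbar, antilinearPart_apply, antilinearPart_apply]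
  simp only [C.fderiv_dbar_apply hg, map_sub]
  rw [hcomm, hsymm (C.vec s), hsymm (C.vec s), hsymm (C.vec (C.lead s)) (C.vec t),
    hsymm (C.vec (C.lead s))]
  abel

variable {f : E → W} {Ω V : Set E} {χ : E → ℝ}

theorem IsSolOn.contDiffAt [Nonempty ι] [CompleteSpace W] (hf : C.IsSolOn f V)
    (hC : Function.Surjective C.ofCoord) (hV : IsOpen V) {x : E} (hx : x ∈ V) {n : WithTop ℕ∞} :
    ContDiffAt ℝ n f x :=
  (hf.analyticOnNhd hC hV x hx).contDiffAt

theorem IsSolOn.dbar_cut_comm [Nonempty ι] [CompleteSpace W] (hf : C.IsSolOn f V)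
    (hC : Function.Surjective C.ofCoord) (hV : IsOpen V) (hχ : ContDiff ℝ ∞ χ)
    (hχV : tsupport (fderiv ℝ χ) ⊆ V) (x : E) (s t : ι) :
    C.dbar (fun y => C.cut χ f y t) x s = C.dbar (fun y => C.cut χ f y s) x t := by
  by_cases hx : x ∈ V
  · have hcut : ∀ r, (fun y => C.cut χ f y r) =ᶠ[𝓝 x] fun y => C.dbar (fun y => χ y • f y) y r :=
      fun r => by
        filter_upwards [hV.mem_nhds hx] with y hy
        rw [hf.dbar_smul_cutoff (hχ.differentiable (by simp)) hy]
    have hg : ContDiffAt ℝ 2 (fun y => χ y • f y) x :=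
      (hχ.of_le (WithTop.coe_le_coe.2 le_top)).contDiffAt.smul (hf.contDiffAt hC hV hx)
    rw [dbar, (hcut t).fderiv_eq, dbar, (hcut s).fderiv_eq]
    exact C.dbar_dbar_comm hg s t
  · have hzero : C.cut χ f =ᶠ[𝓝 x] 0 := notMem_tsupport_iff_eventuallyEq.1
      fun hmem => hx (hχV (C.tsupport_cut_subset χ f hmem))
    have hzero' : ∀ r, (fun y => C.cut χ f y r) =ᶠ[𝓝 x] fun _ => 0 := fun r =>
      hzero.mono fun y hy => by simp [hy]
    rw [dbar, (hzero' t).fderiv_eq, dbar, (hzero' s).fderiv_eq]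
    simp

theorem exists_dbar_eq [CompleteSpace W] (C : CRSystem ι E W) {b : ι} (hb : C.lead b = b)
    {h : E → ι → W} (hh : ContDiff ℝ 1 h) (hc : HasCompactSupport h)
    (hclosed : ∀ x s t, C.dbar (fun y => h y t) x s = C.dbar (fun y => h y s) x t) :
    ∃ u : E → W, Differentiable ℝ u ∧ C.dbar u = h ∧
      ∀ l : E →L[ℝ] ℝ, (∀ t, C.lead t = b → l (C.vec t) = 0) →
        ∀ x, l x ∉ l '' tsupport h → u x = 0 := by
  have : Nonempty {t // C.lead t = b} := ⟨⟨b, hb⟩⟩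
  let m := newtonMass (EuclideanSpace ℝ {t // C.lead t = b})
  let hblock : E → {t // C.lead t = b} → W := fun y t => h y t
  have hsupp : Function.support hblock ⊆ Function.support h := fun y hy h0 =>
    hy (funext fun t => congrFun h0 t)
  have hpot : Differentiable ℝ ((C.block hb).pot hblock) := fun x =>
    ((C.block hb).hasFDerivAt_pot (by fun_prop) (hc.mono hsupp) x).differentiableAt
  refine ⟨fun x => m⁻¹ • (C.block hb).pot hblock x, hpot.const_smul _, funext fun x => ?_,
    fun l hl x hx => ?_⟩
  · rw [dbar, fderiv_fun_const_smul (hpot x), map_smul, ← dbar, C.dbar_pot_block hb hh hc hclosed,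
      inv_smul_smul₀ newtonMass_pos.ne']
  · have hzero : (C.block hb).pot hblock x = 0 := (C.block hb).pot_eq_zero (fun t => hl t t.2)
      fun hmem => hx (image_mono (closure_mono hsupp) hmem)
    simp only [hzero, smul_zero]

theorem IsSolOn.eqOn_of_eventuallyEq [Nonempty ι] [CompleteSpace W]
    (hC : Function.Surjective C.ofCoord) {F : E → W} (hF : C.IsSolOn F V) (hf : C.IsSolOn f V)
    (hV : IsOpen V) (hVc : IsPreconnected V) {x : E} (hx : x ∈ V) (h : F =ᶠ[𝓝 x] f) : EqOn F f V :=
  (hF.analyticOnNhd hC hV).eqOn_of_preconnected_of_eventuallyEq (hf.analyticOnNhd hC hV) hVc hx h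

theorem IsSolOn.one_sub_smul_add (hf : C.IsSolOn f V) (hχ : Differentiable ℝ χ)
    (hχ1 : ∀ x ∈ Ω \ V, χ =ᶠ[𝓝 x] 1) {u : E → W} (hu : Differentiable ℝ u)
    (hdu : C.dbar u = C.cut χ f) : C.IsSolOn (fun x => (1 - χ x) • f x + u x) (Ω ∪ V) := by
  intro x hx
  by_cases hxV : x ∈ V
  · have hχ' : DifferentiableAt ℝ (fun y => 1 - χ y) x := (hχ x).const_sub 1
    have hd : DifferentiableAt ℝ (fun y => (1 - χ y) • f y) x := hχ'.smul (hf x hxV).1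
    refine ⟨hd.add (hu x), ?_⟩
    rw [dbar, fderiv_fun_add hd (hu x), map_add, ← dbar, ← dbar, hdu,
      C.dbar_smul hχ' (hf x hxV).1, (hf x hxV).2, cut, cut, fderiv_const_sub]
    rw [smul_zero, zero_add, ← map_add]
    convert map_zero C.antilinearPart
    ext; simp
  · have hone := hχ1 x ⟨hx.resolve_right hxV, hxV⟩
    have hF : (fun y => (1 - χ y) • f y + u y) =ᶠ[𝓝 x] u := by
      filter_upwards [hone] with y hy
      simp [hy]
    refine ⟨hF.differentiableAt_iff.2 (hu x), ?_⟩
    rw [dbar, hF.fderiv_eq, ← dbar, hdu, cut, hone.fderiv_eq]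
    simp

theorem exists_ne_zero_forall_lead_eq (C : CRSystem ι E W) (hC : Function.Surjective C.ofCoord)
    {b j : ι} (hj : C.lead j ≠ b) :
    ∃ l : E →L[ℝ] ℝ, l ≠ 0 ∧ ∀ t, C.lead t = b → l (C.vec t) = 0 := by
  have hvec : ∀ t, (C.coordEquiv hC).symm (C.vec t) = EuclideanSpace.single t 1 := fun t => by
    rw [ContinuousLinearEquiv.symm_apply_eq]
    exact (C.ofCoord_single t).symm
  refine ⟨EuclideanSpace.proj j ∘L ((C.coordEquiv hC).symm : E →L[ℝ] EuclideanSpace ℝ ι),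
    fun hl => ?_, fun t ht => ?_⟩
  · simpa [hvec] using DFunLike.congr_fun hl (C.vec j)
  · have hjt : j ≠ t := fun h => hj (h ▸ ht)
    simp [hvec, hjt]

theorem IsSolOn.exists_extension [CompleteSpace W] (hf : C.IsSolOn f V)
    (hC : Function.Surjective C.ofCoord) {b j : ι} (hb : C.lead b = b) (hj : C.lead j ≠ b)
    (hΩ : IsOpen Ω) (hne : Ω.Nonempty) (hbdd : IsBounded Ω) (hV : IsOpen V)
    (hVc : IsPreconnected V) (hΩV : frontier Ω ⊆ V) :
    ∃ F : E → W, C.IsSolOn F (Ω ∪ V) ∧ EqOn F f V := by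
  have : Nonempty ι := ⟨b⟩
  have := C.finiteDimensional hC
  have : ProperSpace E := FiniteDimensional.proper ℝ E
  have hKΩ : closure Ω \ V ⊆ Ω := fun x hx =>
    by_contra fun hxΩ => hx.2 (hΩV ⟨hx.1, by rwa [hΩ.interior_eq]⟩)
  obtain ⟨χ, hχ, hχc, hχΩ, hχ1⟩ :=
    exists_contDiff_cutoff (hbdd.isCompact_closure.diff hV) hΩ hKΩ
  have hχV : tsupport (fderiv ℝ χ) ⊆ V := fun x hx => by_contra fun hxV => by
    have hone := hχ1 x ⟨subset_closure (hχΩ (tsupport_fderiv_subset ℝ hx)), hxV⟩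
    exact notMem_tsupport_iff_eventuallyEq.2 (hone.fderiv.trans (by simp [fderiv_one])) hx
  obtain ⟨u, hu, hdu, hu0⟩ := C.exists_dbar_eq hb
    (C.contDiff_cut (n := 1) hχ fun x hx => hf.contDiffAt hC hV (hχV hx))
    (C.hasCompactSupport_cut hχc f) (hf.dbar_cut_comm hC hV hχ hχV)
  let F : E → W := fun x => (1 - χ x) • f x + u x
  have hF : C.IsSolOn F (Ω ∪ V) := hf.one_sub_smul_add (hχ.differentiable (by simp))
    (fun x hx => hχ1 x ⟨subset_closure hx.1, hx.2⟩) hu hdu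
  obtain ⟨l, hl, hlb⟩ := C.exists_ne_zero_forall_lead_eq hC hj
  obtain ⟨x, hx, hlx⟩ := exists_mem_frontier_forall_lt hl hΩ hne hbdd
  have hnot : l x ∉ l '' tsupport χ := fun ⟨y, hy, hyx⟩ => (hlx y (hχΩ hy)).ne hyx
  have hnear : F =ᶠ[𝓝 x] f := by
    have hopen := ((hχc.image l.continuous).isClosed.preimage l.continuous).isOpen_compl
    filter_upwards [hopen.mem_nhds hnot] with y hy
    have hy' : y ∉ tsupport χ := fun hmem => hy ⟨y, hmem, rfl⟩
    have hsupp := (C.tsupport_cut_subset χ f).trans (tsupport_fderiv_subset ℝ)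
    simp [F, image_eq_zero_of_notMem_tsupport hy',
      hu0 l hlb y fun hmem => hy (image_mono hsupp hmem)]
  exact ⟨F, hF, IsSolOn.eqOn_of_eventuallyEq hC (fun y hy => hF y (.inr hy)) hf hV hVc (hΩV hx)
    hnear⟩

end CRSystem

namespace BlockSeq

variable {q r : ℕ} (S : BlockSeq q r)

theorem exists_mem_block (t : Fin q) : ∃ k, t ∈ S.block k := by
  by_contra! h
  have hle : ∀ k : Fin (r + 1), S.s k ≤ t := fun k => by
    induction k using Fin.induction with
    | zero => simp [S.s_zero]
    | succ k ih =>
      by_contra! hlt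
      exact h k (by simp [block, ih, hlt])
  have hlast := hle (Fin.last r)
  rw [S.s_last] at hlast
  exact absurd t.2 (not_lt.2 hlast)

theorem eq_of_mem_block {k k' : Fin r} {t : Fin q} (h : t ∈ S.block k) (h' : t ∈ S.block k') :
    k = k' := by
  simp only [block, Finset.mem_filter, Finset.mem_univ, true_and] at h h'
  by_contra hne
  rcases lt_or_gt_of_ne hne with hlt | hlt
  · have : S.s k.succ ≤ S.s k'.castSucc := S.strictMono.monotone (Fin.succ_le_castSucc_iff.2 hlt)
    omega
  · have : S.s k'.succ ≤ S.s k.castSucc := S.strictMono.monotone (Fin.succ_le_castSucc_iff.2 hlt)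
    omega

theorem lead_mem_block (k : Fin r) : S.lead k ∈ S.block k := by
  simp only [block, lead, Finset.mem_filter, Finset.mem_univ, true_and, le_refl]
  exact S.strictMono Fin.castSucc_lt_succ

/-- The index of the block containing `t`. -/
noncomputable def blockOf (t : Fin q) : Fin r := (S.exists_mem_block t).choose

theorem mem_block_blockOf (t : Fin q) : t ∈ S.block (S.blockOf t) :=
  (S.exists_mem_block t).choose_spec

theorem blockOf_eq_iff {t : Fin q} {k : Fin r} : S.blockOf t = k ↔ t ∈ S.block k :=
  ⟨fun h => h ▸ S.mem_block_blockOf t, fun h => S.eq_of_mem_block (S.mem_block_blockOf t) h⟩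

theorem blockOf_lead (k : Fin r) : S.blockOf (S.lead k) = k :=
  S.blockOf_eq_iff.2 (S.lead_mem_block k)

theorem filter_blockOf_eq (k : Fin r) :
    (Finset.univ.filter fun t => S.blockOf t = k) = S.block k := by
  ext t
  simp [S.blockOf_eq_iff]

end BlockSeq

variable {Λ : Type*} [NormedRing Λ] [NormedAlgebra ℝ Λ] {𝒜 : ZMod 2 → Submodule ℝ Λ} {p q r : ℕ}

theorem IsSupercommutative.commute (hΛ : IsSupercommutative 𝒜) :
    ∀ x ∈ 𝒜 0, ∀ y ∈ 𝒜 0, Commute x y := fun x hx y hy =>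
  (hΛ 0 0 x y hx hy).trans (by simp)

/-- The index set of the real coordinates of `Λ₀ⁿ × Λ₁ᵐ`. -/
abbrev CoordIdx (n m p q : ℕ) : Type := (Σ _ : Fin n, Fin (p + 1)) ⊕ (Σ _ : Fin m, Fin q)

/-- The leading coordinate `y_i^0` or `θ_l^{s_k}` of the block of a coordinate. -/
noncomputable def coordLead (n m p : ℕ) (S : BlockSeq q r) : CoordIdx n m p q → CoordIdx n m p q :=
  Sum.elim (fun t => .inl ⟨t.1, 0⟩) fun t => .inr ⟨t.1, S.lead (S.blockOf t.2)⟩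

/-- The coefficient `e_j` or `a_t` of a coordinate in the Cauchy–Riemann equations. -/
noncomputable def coordCoeff (n m : ℕ) (e : Module.Basis (Fin (p + 1)) ℝ (𝒜 0)) (a : Fin q → 𝒜 0) :
    CoordIdx n m p q → 𝒜 0 :=
  Sum.elim (fun t => e t.2) fun t => a t.2

theorem sum_sq_coordCoeff (n m : ℕ) {e : Module.Basis (Fin (p + 1)) ℝ (𝒜 0)}
    (hA0 : ConditionA0 𝒜 e) {ε : Module.Basis (Fin q) ℝ (𝒜 1)} {S : BlockSeq q r}
    {a : Fin q → 𝒜 0} (hA1 : ConditionA1 𝒜 ε S a) (b : CoordIdx n m p q) :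
    ∑ t with coordLead n m p S t = b, (coordCoeff n m e a t : Λ) ^ 2 = 0 := by
  have heven : ∀ i : Fin n, ∑ j : Fin (p + 1),
      (if (.inl ⟨i, 0⟩ : CoordIdx n m p q) = b then (e j : Λ) ^ 2 else 0) = 0 := fun i => by
    split_ifs
    exacts [hA0.2, Finset.sum_const_zero]
  have hodd : ∀ l : Fin m, ∑ t : Fin q,
      (if (.inr ⟨l, S.lead (S.blockOf t)⟩ : CoordIdx n m p q) = b then (a t : Λ) ^ 2 else 0) = 0 :=
    fun l => by
      rw [← Finset.sum_fiberwise Finset.univ S.blockOf]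
      refine Finset.sum_eq_zero fun k _ => ?_
      rw [S.filter_blockOf_eq, Finset.sum_congr rfl fun t ht => by rw [S.blockOf_eq_iff.2 ht]]
      split_ifs
      exacts [(hA1 k).2.2, Finset.sum_const_zero]
  rw [Finset.sum_filter, Fintype.sum_sum_type, Fintype.sum_sigma, Fintype.sum_sigma]
  exact (congrArg₂ (· + ·) (Finset.sum_eq_zero fun i _ => heven i)
    (Finset.sum_eq_zero fun l _ => hodd l)).trans (add_zero 0)

/-- The basis of `Λ₀ⁿ × Λ₁ᵐ` given by bases of `Λ₀` and `Λ₁`. -/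
noncomputable def superBasis (n m : ℕ) (e : Module.Basis (Fin (p + 1)) ℝ (𝒜 0))
    (ε : Module.Basis (Fin q) ℝ (𝒜 1)) :
    Module.Basis (CoordIdx n m p q) ℝ (Superspace 𝒜 n m) :=
  (Pi.basis fun _ => e).prod (Pi.basis fun _ => ε)

theorem superBasis_inl (n m : ℕ) (e : Module.Basis (Fin (p + 1)) ℝ (𝒜 0))
    (ε : Module.Basis (Fin q) ℝ (𝒜 1)) (i : Fin n) (j : Fin (p + 1)) :
    superBasis n m e ε (.inl ⟨i, j⟩) = (Pi.single i (e j), 0) := by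
  simp [superBasis, Module.Basis.prod_apply]

theorem superBasis_inr (n m : ℕ) (e : Module.Basis (Fin (p + 1)) ℝ (𝒜 0))
    (ε : Module.Basis (Fin q) ℝ (𝒜 1)) (l : Fin m) (t : Fin q) :
    superBasis n m e ε (.inr ⟨l, t⟩) = (0, Pi.single l (ε t)) := by
  simp [superBasis, Module.Basis.prod_apply]

/-- The Cauchy–Riemann equations of superanalysis, in real coordinates. -/
noncomputable def superSystem (n m : ℕ) (hΛ : ∀ x ∈ 𝒜 0, ∀ y ∈ 𝒜 0, Commute x y)
    {e : Module.Basis (Fin (p + 1)) ℝ (𝒜 0)} (hA0 : ConditionA0 𝒜 e)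
    {ε : Module.Basis (Fin q) ℝ (𝒜 1)} {S : BlockSeq q r} {a : Fin q → 𝒜 0}
    (hA1 : ConditionA1 𝒜 ε S a) : CRSystem (CoordIdx n m p q) (Superspace 𝒜 n m) Λ where
  vec := superBasis n m e ε
  linearIndependent := (superBasis n m e ε).linearIndependent
  lead := coordLead n m p S
  coeff t := ContinuousLinearMap.mul ℝ Λ (coordCoeff n m e a t)
  comm s t := by
    ext w
    have h := hΛ _ (coordCoeff n m e a s).2 _ (coordCoeff n m e a t).2
    exact h.left_comm w
  sum_sq b := by
    ext w
    simp only [sum_apply, pow_two, mul_apply_eq_comp, ContinuousLinearMap.mul_apply',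
      ← mul_assoc, ← Finset.sum_mul]
    simp only [← pow_two, sum_sq_coordCoeff n m hA0 hA1 b, zero_mul, zero_apply]

section Components

variable {n m : ℕ} {e : Module.Basis (Fin (p + 1)) ℝ (𝒜 0)} {ε : Module.Basis (Fin q) ℝ (𝒜 1)}
  {S : BlockSeq q r} {a : Fin q → 𝒜 0} {f : Superspace 𝒜 n m → Λ} {x : Superspace 𝒜 n m}

theorem cauchyRiemann_apply_even (i : Fin n) (j : Fin p) :
    cauchyRiemann e ε S a f x (Pi.single i (e j.succ), 0) =
      partialY e f x i j.succ - (e j.succ : Λ) * partialY e f x i 0 := by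
  have hdθ : ∀ l t, dθ (n := n) ε l t (Pi.single i (e j.succ), (0 : Fin m → 𝒜 1)) = 0 := by
    simp [dθ]
  have hdy : ∀ i' (j' : Fin p), dy (m := m) e i' j'.succ (Pi.single i (e j.succ), 0) =
      if i' = i ∧ j' = j then 1 else 0 := fun i' j' => by
    by_cases hi : i' = i
    · subst hi
      simp [dy, Finsupp.single_apply, eq_comm]
    · simp [dy, hi]
  simp only [cauchyRiemann, LinearMap.add_apply, LinearMap.sum_apply, LinearMap.smulRight_apply,
    hdθ, hdy, zero_smul, Finset.sum_const_zero, add_zero]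
  rw [Finset.sum_eq_single i (fun i' _ hi => by simp [hi]) (by simp),
    Finset.sum_eq_single j (fun j' _ hj => by simp [hj]) (by simp)]
  simp

theorem cauchyRiemann_apply_odd (l : Fin m) (k : Fin r) {t : Fin q}
    (ht : t ∈ (S.block k).erase (S.lead k)) :
    cauchyRiemann e ε S a f x (0, Pi.single l (ε t)) =
      partialθ ε f x l t - (a t : Λ) * partialθ ε f x l (S.lead k) := by
  have hdy : ∀ i j, dy (m := m) e i j ((0 : Fin n → 𝒜 0), Pi.single l (ε t)) = 0 := by
    simp [dy]
  have hdθ : ∀ l' t', dθ (n := n) ε l' t' (0, Pi.single l (ε t)) =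
      if l' = l ∧ t' = t then 1 else 0 := fun l' t' => by
    by_cases hl : l' = l
    · subst hl
      simp [dθ, Finsupp.single_apply, eq_comm]
    · simp [dθ, hl]
  simp only [cauchyRiemann, LinearMap.add_apply, LinearMap.sum_apply, LinearMap.smulRight_apply,
    hdy, hdθ, zero_smul, Finset.sum_const_zero, zero_add]
  rw [Finset.sum_eq_single l (fun l' _ hl => by simp [hl]) (by simp),
    Finset.sum_eq_single k ?_ (by simp),
    Finset.sum_eq_single t (fun t' _ ht' => by simp [ht']) (fun h => absurd ht h)]
  · simp
  · refine fun k' _ hk => Finset.sum_eq_zero fun t' ht' => ?_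
    have : t' ≠ t := fun h => hk (S.eq_of_mem_block (h ▸ Finset.mem_of_mem_erase ht')
      (Finset.mem_of_mem_erase ht))
    simp [this]

theorem cauchyRiemann_eq_zero_iff :
    cauchyRiemann e ε S a f x = 0 ↔
      (∀ i (j : Fin p), partialY e f x i j.succ = (e j.succ : Λ) * partialY e f x i 0) ∧
      ∀ l k, ∀ t ∈ (S.block k).erase (S.lead k),
        partialθ ε f x l t = (a t : Λ) * partialθ ε f x l (S.lead k) := by
  refine ⟨fun h => ⟨fun i j => ?_, fun l k t ht => ?_⟩, fun h => ?_⟩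
  · rw [← sub_eq_zero, ← cauchyRiemann_apply_even (ε := ε) (S := S) (a := a), h]
    rfl
  · rw [← sub_eq_zero, ← cauchyRiemann_apply_odd (e := e) l k ht, h]
    rfl
  · rw [cauchyRiemann, Finset.sum_eq_zero fun i _ => Finset.sum_eq_zero fun j _ => ?_,
      Finset.sum_eq_zero fun l _ => Finset.sum_eq_zero fun k _ => Finset.sum_eq_zero fun t ht => ?_,
      add_zero]
    · rw [h.2 l k t ht, sub_self]
      ext <;> simp
    · rw [h.1 i j, sub_self]
      ext <;> simp

theorem dbar_superSystem_eq_zero_iff (hΛ : ∀ x ∈ 𝒜 0, ∀ y ∈ 𝒜 0, Commute x y)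
    (hA0 : ConditionA0 𝒜 e) (hA1 : ConditionA1 𝒜 ε S a) :
    (superSystem n m hΛ hA0 hA1).dbar f x = 0 ↔ cauchyRiemann e ε S a f x = 0 := by
  have hdbar : ∀ t, (superSystem n m hΛ hA0 hA1).dbar f x t = fderiv ℝ f x (superBasis n m e ε t) -
      coordCoeff n m e a t * fderiv ℝ f x (superBasis n m e ε (coordLead n m p S t)) := fun t => rfl
  simp only [cauchyRiemann_eq_zero_iff, funext_iff, hdbar, Pi.zero_apply, sub_eq_zero, Sum.forall,
    Sigma.forall, coordLead, coordCoeff, Sum.elim_inl, Sum.elim_inr, superBasis_inl,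
    superBasis_inr, partialY, partialθ]
  refine and_congr (forall_congr' fun i => ?_) (forall_congr' fun l => ⟨fun h k t ht => ?_,
    fun h t => ?_⟩)
  · rw [Fin.forall_fin_succ, hA0.1, one_mul]
    exact and_iff_right rfl
  · rw [h t, S.blockOf_eq_iff.2 (Finset.mem_of_mem_erase ht)]
  · obtain ht | ht := eq_or_ne t (S.lead (S.blockOf t))
    · rw [← ht, show (a t : Λ) = 1 from ht ▸ (hA1 _).2.1, one_mul]
    · exact h (S.blockOf t) t (Finset.mem_erase.2 ⟨ht, S.mem_block_blockOf t⟩)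

theorem isSolOn_superSystem_iff (hΛ : ∀ x ∈ 𝒜 0, ∀ y ∈ 𝒜 0, Commute x y)
    (hA0 : ConditionA0 𝒜 e) (hA1 : ConditionA1 𝒜 ε S a) {D : Set (Superspace 𝒜 n m)} :
    (superSystem n m hΛ hA0 hA1).IsSolOn f D ↔ QSDifferentiableOn e ε S a f D :=
  forall₂_congr fun _ _ => and_congr_right fun _ => dbar_superSystem_eq_zero_iff hΛ hA0 hA1

theorem ofCoord_superSystem_surjective (hΛ : ∀ x ∈ 𝒜 0, ∀ y ∈ 𝒜 0, Commute x y)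
    (hA0 : ConditionA0 𝒜 e) (hA1 : ConditionA1 𝒜 ε S a) :
    Function.Surjective (superSystem n m hΛ hA0 hA1).ofCoord := fun x => by
  refine ⟨WithLp.toLp 2 ((superBasis n m e ε).repr x), ?_⟩
  rw [CRSystem.ofCoord_apply]
  exact (superBasis n m e ε).sum_repr x

end Components

theorem exists_two_blocks {n m : ℕ} (ε : Module.Basis (Fin q) ℝ (𝒜 1)) (S : BlockSeq q r)
    (hnm : 2 ≤ n + m) (hodd : 𝒜 1 = ⊥ → 2 ≤ n) :
    ∃ b j : CoordIdx n m p q, coordLead n m p S b = b ∧ coordLead n m p S j ≠ b := by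
  by_cases hn : 2 ≤ n
  · refine ⟨Sum.inl ⟨⟨0, by omega⟩, 0⟩, Sum.inl ⟨⟨1, by omega⟩, 0⟩, rfl, ?_⟩
    simp [coordLead]
  · have hq : 0 < q := by
      rw [Nat.pos_iff_ne_zero]
      rintro rfl
      refine hn (hodd ?_)
      have : Subsingleton (𝒜 1) := ε.repr.toEquiv.subsingleton
      exact (Submodule.eq_bot_iff _).2 fun y hy => by
        simpa using congrArg Subtype.val (Subsingleton.elim (⟨y, hy⟩ : 𝒜 1) 0)
    let t₀ := S.lead (S.blockOf ⟨0, hq⟩)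
    have ht₀ : S.lead (S.blockOf t₀) = t₀ := by
      simp only [t₀, S.blockOf_lead]
    by_cases hn1 : n = 1
    · refine ⟨Sum.inl ⟨⟨0, by omega⟩, 0⟩, Sum.inr ⟨⟨0, by omega⟩, t₀⟩, rfl, ?_⟩
      simp [coordLead]
    · refine ⟨Sum.inr ⟨⟨0, by omega⟩, t₀⟩, Sum.inr ⟨⟨1, by omega⟩, t₀⟩, ?_, ?_⟩
      · simp [coordLead, ht₀]
      · simp [coordLead]

end SuperAnalysis

theorem mainTheorem3_general {Λ : Type*} [NormedRing Λ] [NormedAlgebra ℝ Λ] [CompleteSpace Λ]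
    {𝒜 : ZMod 2 → Submodule ℝ Λ} (hΛ : ∀ x ∈ 𝒜 0, ∀ y ∈ 𝒜 0, Commute x y) {p q r : ℕ}
    {e : Module.Basis (Fin (p + 1)) ℝ (𝒜 0)} (hA0 : SuperAnalysis.ConditionA0 𝒜 e)
    {ε : Module.Basis (Fin q) ℝ (𝒜 1)} {S : SuperAnalysis.BlockSeq q r} {a : Fin q → 𝒜 0}
    (hA1 : SuperAnalysis.ConditionA1 𝒜 ε S a) {n m : ℕ} (hnm : 2 ≤ n + m)
    (hodd : 𝒜 1 = ⊥ → 2 ≤ n) {Ω : Set (SuperAnalysis.Superspace 𝒜 n m)} (hΩ_open : IsOpen Ω)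
    (hΩ_bdd : Bornology.IsBounded Ω) (hΩ_bdry : IsConnected (frontier Ω))
    {V : Set (SuperAnalysis.Superspace 𝒜 n m)} (hV_open : IsOpen V) (hV : frontier Ω ⊆ V)
    {f : SuperAnalysis.Superspace 𝒜 n m → Λ}
    (hf : SuperAnalysis.QSDifferentiableOn e ε S a f V) :
    ∃ F : SuperAnalysis.Superspace 𝒜 n m → Λ,
      SuperAnalysis.QSDifferentiableOn e ε S a F
        (Ω ∪ ⋃ b ∈ frontier Ω, connectedComponentIn V b) ∧
      Set.EqOn F f (⋃ b ∈ frontier Ω, connectedComponentIn V b) := by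
  obtain ⟨x, hx⟩ := hΩ_bdry.nonempty
  have hfrontier : frontier Ω ⊆ connectedComponentIn V x :=
    hΩ_bdry.isPreconnected.subset_connectedComponentIn hx hV
  have hV₀ : ⋃ b ∈ frontier Ω, connectedComponentIn V b = connectedComponentIn V x :=
    (Set.iUnion₂_congr fun b hb => (connectedComponentIn_eq (hfrontier hb)).symm).trans
      (Set.biUnion_const ⟨x, hx⟩ _)
  have hsol := (SuperAnalysis.isSolOn_superSystem_iff hΛ hA0 hA1).2
    fun y hy => hf y (connectedComponentIn_subset V x hy)
  obtain ⟨b, j, hb, hj⟩ := SuperAnalysis.exists_two_blocks (n := n) (p := p) ε S hnm hodd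
  simp only [hV₀, ← SuperAnalysis.isSolOn_superSystem_iff hΛ hA0 hA1]
  exact hsol.exists_extension (SuperAnalysis.ofCoord_superSystem_surjective hΛ hA0 hA1) hb hj
    hΩ_open (closure_nonempty_iff.1 ⟨x, frontier_subset_closure hx⟩) hΩ_bdd
    hV_open.connectedComponentIn isPreconnected_connectedComponentIn hfrontier

theorem mainTheorem3 {Λ : Type*} [NormedRing Λ] [NormedAlgebra ℝ Λ] [FiniteDimensional ℝ Λ]
    (𝒜 : ZMod 2 → Submodule ℝ Λ) [GradedAlgebra 𝒜] (hΛ : SuperAnalysis.IsSupercommutative 𝒜)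
    {p q r : ℕ} (e : Module.Basis (Fin (p + 1)) ℝ (𝒜 0)) (hA0 : SuperAnalysis.ConditionA0 𝒜 e)
    (ε : Module.Basis (Fin q) ℝ (𝒜 1)) (S : SuperAnalysis.BlockSeq q r) (a : Fin q → 𝒜 0)
    (hA1 : SuperAnalysis.ConditionA1 𝒜 ε S a)
    {n m : ℕ} (hnm : 2 ≤ n + m)
    -- if `Λ₁ = 0`, the odd variables do not count
    (hodd : 𝒜 1 = ⊥ → 2 ≤ n)
    (Ω : Set (SuperAnalysis.Superspace 𝒜 n m)) (hΩ_open : IsOpen Ω) (hΩ_conn : IsConnected Ω)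
    (hΩ_bdd : Bornology.IsBounded Ω) (hΩ_bdry : IsConnected (frontier Ω))
    (V : Set (SuperAnalysis.Superspace 𝒜 n m)) (hV_open : IsOpen V) (hV : frontier Ω ⊆ V)
    (f : SuperAnalysis.Superspace 𝒜 n m → Λ)
    (hf : SuperAnalysis.QSDifferentiableOn e ε S a f V) :
    -- the union below is the connected component of `V` that contains `frontier Ω`
    ∃ F : SuperAnalysis.Superspace 𝒜 n m → Λ,
      SuperAnalysis.QSDifferentiableOn e ε S a F
        (Ω ∪ ⋃ b ∈ frontier Ω, connectedComponentIn V b) ∧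
      Set.EqOn F f (⋃ b ∈ frontier Ω, connectedComponentIn V b) := by
  have := FiniteDimensional.complete ℝ Λ
  exact mainTheorem3_general hΛ.commute hA0 hA1 hnm hodd hΩ_open hΩ_bdd hΩ_bdry hV_open hV hf
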